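/- Let $N\ge 1$ be an integer, $s\in(0,1)$, $T>0$, $S_T:=\mathbb{R}^N\times(0,T]$, and $$\mathcal L^s(\mathbb{R}^N):=\Big\{f:\mathbb{R}^N\to\mathbb{R}\ \text{measurable}:\ \int_{\mathbb{R}^N}\frac{|f(x)|}{1+|x|^{N+2s}}\,dx<\infty\Big\}.$$ Let $\rho\in C(\mathbb{R}^N)$ satisfy, for some $\alpha\ge 0$ and $C_0>0$, $$\rho(x)\ge C_0(1+|x|^2)^{-\alpha/2}\qquad\text{for all }x\in\mathbb{R}^N .$$ Let $\beta>0$, put $\psi(x):=(1+|x|^2)^{-\beta/2}$, and assume that one of the following conditions holds: (i) $0<\beta\le N-2s$ and $\alpha\le 2$; (ii) $N-2s<\beta<N$ and $\alpha\le 2s$; (iii) $\beta=N$ and $\alpha<2s$; (iv) $\beta>N$ and $\alpha+\beta\le 2s+N$. Let $u$ be a classical solution of the Cauchy problem $$\rho\,u_t-\Delta u+(-\Delta)^su=0\ \text{ in }S_T,\qquad u=0\ \text{ in }\mathbb{R}^N\times\{0\},$$ that is, $u\in C^2(\mathbb{R}^N\times[0,T])$, $u\in L^1\big((0,T),\mathcal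 L^s(\mathbb{R}^N)\big)$, $u(\cdot,t)\in\mathcal L^s(\mathbb{R}^N)$ for every $t\in(0,T]$, $u(x,0)=0$ for every $x\in\mathbb{R}^N$, and for every $(x,t)\in S_T$ the equation holds pointwise, where $$(-\Delta)^su(x,t)=C_{N,s}\lim_{\varepsilon\to0^+}\int_{\{|x-y|\ge\varepsilon\}}\frac{u(x,t)-u(y,t)}{|x-y|^{N+2s}}\,dy,\qquad C_{N,s}=\frac{2^{2s-1}\,2s\,\Gamma\big(\frac{N+2s}{2}\big)}{\pi^{N/2}\,\Gamma(1-s)},$$ and $u_t$ at $t=T$ is the derivative from the left. Suppose that for some real $p\ge1$ we have $|u(\cdot,t)|^p\in\mathcal L^s(\mathbb{R}^N)$ for every $t\in(0,T]$, and that $u\in L^p_\psi(S_T)$, i.e. $\int_0^T\int_{\mathbb{R}^N}|u(x,t)|^p\psi(x)\,dx\,dt<\infty$. Then $u\equiv0$ in $S_T$. -/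

import Mathlib

open MeasureTheory Filter Topology Set
open scoped ENNReal

noncomputable section

namespace MixedParabolic

/-- The space `ℝ^N` with its Euclidean norm. -/
abbrev Space (N : ℕ) : Type := EuclideanSpace ℝ (Fin N)

/-- The normalization constant `C_{N,s}` of the fractional Laplacian. -/
def fracConst (N : ℕ) (s : ℝ) : ℝ :=
  (2 ^ (2 * s - 1) * (2 * s) * Real.Gamma (((N : ℝ) + 2 * s) / 2)) /
    (Real.pi ^ ((N : ℝ) / 2) * Real.Gamma (1 - s))

/-- `(-Δ)^s f (x)` exists and equals `L`, that is, the principal value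
`C_{N,s} P.V. ∫ (f x - f y) / |x - y|^(N + 2s) dy` converges to `L`. -/
def HasFracLaplacianAt {N : ℕ} (s : ℝ) (f : Space N → ℝ) (x : Space N) (L : ℝ) : Prop :=
  Tendsto
    (fun ε : ℝ => fracConst N s *
      ∫ y in {y : Space N | ε ≤ ‖x - y‖}, (f x - f y) / ‖x - y‖ ^ ((N : ℝ) + 2 * s))
    (𝓝[>] 0) (𝓝 L)

/-- The norm `∫ |f x| / (1 + |x|^(N + 2s)) dx`, with values in `[0, ∞]`. -/
def lsNorm {N : ℕ} (s : ℝ) (f : Space N → ℝ) : ℝ≥0∞ :=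
  ∫⁻ x, ENNReal.ofReal (|f x| / (1 + ‖x‖ ^ ((N : ℝ) + 2 * s)))

/-- Membership in `𝓛^s(ℝ^N)`. -/
def MemLs {N : ℕ} (s : ℝ) (f : Space N → ℝ) : Prop :=
  AEStronglyMeasurable f volume ∧ lsNorm s f < ∞

/-- Membership in `L^1((0,T), 𝓛^s(ℝ^N))`. -/
def MemL1Ls {N : ℕ} (s T : ℝ) (u : Space N → ℝ → ℝ) : Prop :=
  AEStronglyMeasurable (fun z : Space N × ℝ => u z.1 z.2)
      (volume.restrict (univ ×ˢ Ioo 0 T)) ∧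
    ∫⁻ t in Ioo 0 T, lsNorm s (fun x => u x t) < ∞

/-- The weight `ψ_β(x) = (1 + |x|²)^(-β/2)`. -/
def psi {N : ℕ} (β : ℝ) (x : Space N) : ℝ := (1 + ‖x‖ ^ 2) ^ (-β / 2)

/-- Membership in `L^p_ψ(S_T)` for `ψ = ψ_β` and `S_T = ℝ^N × (0,T]`. -/
def MemLpPsi {N : ℕ} (p β T : ℝ) (u : Space N → ℝ → ℝ) : Prop :=
  AEStronglyMeasurable (fun z : Space N × ℝ => u z.1 z.2)
      (volume.restrict (univ ×ˢ Ioc 0 T)) ∧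
    ∫⁻ z in (univ : Set (Space N)) ×ˢ Ioc 0 T,
      ENNReal.ofReal (|u z.1 z.2| ^ p * psi β z.1) < ∞

/-- Assumption `(H₀)` on the coefficient `ρ`, with its exponent `α` and constant `C₀`. -/
structure AssumptionH0 {N : ℕ} (ρ : Space N → ℝ) (α C₀ : ℝ) : Prop where
  continuous : Continuous ρ
  alpha_nonneg : 0 ≤ α
  const_pos : 0 < C₀
  lower_bound : ∀ x, C₀ * (1 + ‖x‖ ^ 2) ^ (-α / 2) ≤ ρ x

/-- One of the four conditions relating `α`, `β`, `N` and `s` holds. -/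
def ExponentCondition (N : ℕ) (s α β : ℝ) : Prop :=
  (0 < β ∧ β ≤ N - 2 * s ∧ α ≤ 2) ∨
  (N - 2 * s < β ∧ β < N ∧ α ≤ 2 * s) ∨
  (β = N ∧ α < 2 * s) ∨
  (N < β ∧ α + β ≤ 2 * s + N)

/-- Classical solutions of `ρ u_t - Δu + (-Δ)^s u = 0` in `S_T = ℝ^N × (0,T]`.
At `t = T` the time derivative is the one from the left. -/
structure IsSolutionEquation {N : ℕ} (s T : ℝ) (ρ : Space N → ℝ) (u : Space N → ℝ → ℝ) :
    Prop where
  contDiffOn : ContDiffOn ℝ 2 (fun z : Space N × ℝ => u z.1 z.2) (univ ×ˢ Ioc 0 T)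
  memLs : ∀ t ∈ Ioc 0 T, MemLs s (fun x => u x t)
  equation : ∀ x, ∀ t ∈ Ioc 0 T, ∃ L : ℝ, HasFracLaplacianAt s (fun y => u y t) x L ∧
    ρ x * derivWithin (fun τ => u x τ) (Ioc 0 T) t
      - (Laplacian.laplacian (fun y : Space N => u y t) : Space N → ℝ) x + L = 0

/-- Classical solutions of the Cauchy problem with zero initial datum. -/
structure IsSolutionProblem {N : ℕ} (s T : ℝ) (ρ : Space N → ℝ) (u : Space N → ℝ → ℝ) :
    Prop where
  contDiffOn : ContDiffOn ℝ 2 (fun z : Space N × ℝ => u z.1 z.2) (univ ×ˢ Icc 0 T)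
  memL1Ls : MemL1Ls s T u
  solution : IsSolutionEquation s T ρ u
  initial : ∀ x, u x 0 = 0

end MixedParabolic

end

/-!
Write `𝓛 = Δ - (-Δ)^s` and `⟨x⟩ = (1 + |x|²)^(1/2)`, and let `G` be a convex `C¹` substitute for
`|r|^p` that vanishes only at `0`. The equation `ρ u_t = 𝓛 u` is tested with `G'(u) φ`, where
`φ = φ_R ψ_β` is the weight cut off at radius `R`. To avoid integrations by parts, `𝓛` is first
discretized to `𝓛_h`: a second difference quotient of step `h` for `Δ`, and the truncation to
`|z| ≥ h` for `(-Δ)^s`. These operators are symmetric and satisfy the convexity inequality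
`G'(u) 𝓛_h u ≤ 𝓛_h (G ∘ u)` exactly, so that `∫ G'(u) φ 𝓛_h u ≤ ∫ G(u) 𝓛_h φ`; then `h → 0`.

The conditions on `α` and `β` say that `𝓛_h ψ_β ≤ K ⟨x⟩^(-α) ψ_β ≤ (K / C₀) ρ ψ_β` uniformly in `h`.
In case (i) the weight is first replaced by the smaller one with exponent `N - 2s`. Inversion in
the sphere of radius `⟨x⟩` about `x` turns its truncated fractional Laplacian into the integral of
`|w|^(-β) - ψ_β(x + w)` over a ball centred at `0`, which is nonnegative by rearrangement.

A Gronwall argument in time then bounds `∫ ρ φ G(u(t))` by the cut-off error, which is controlled by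
`|u|^p ψ_β` and vanishes as `R → ∞` by dominated convergence.
-/

open MeasureTheory Filter Topology Set Metric
open scoped ENNReal NNReal

noncomputable section

namespace MixedParabolic

/-! ### The weight -/

section Bracket

variable {E : Type*} [NormedAddCommGroup E]

/-- The Japanese bracket `⟨x⟩ = (1 + |x|²)^(1/2)`, so that `ψ_β = ⟨x⟩^(-β)`; it is the length scale
on which `ψ_β` varies near `x`. -/
def bracket (x : E) : ℝ := √(1 + ‖x‖ ^ 2)

lemma bracket_sq (x : E) : bracket x ^ 2 = 1 + ‖x‖ ^ 2 :=
  Real.sq_sqrt (by positivity)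

lemma one_le_bracket (x : E) : 1 ≤ bracket x :=
  Real.one_le_sqrt.2 (le_add_of_nonneg_right (by positivity))

lemma bracket_pos (x : E) : 0 < bracket x := one_pos.trans_le (one_le_bracket x)

lemma norm_le_bracket (x : E) : ‖x‖ ≤ bracket x :=
  Real.le_sqrt_of_sq_le (by linarith)

lemma bracket_add_le (x z : E) : bracket (x + z) ≤ bracket x + ‖z‖ := by
  refine Real.sqrt_le_iff.2 ⟨add_nonneg (bracket_pos x).le (norm_nonneg z), ?_⟩
  nlinarith [bracket_sq x, norm_nonneg z, norm_nonneg (x + z), norm_add_le x z, norm_le_bracket x]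

lemma half_bracket_le {x z : E} (hz : ‖z‖ ≤ bracket x / 2) : bracket x / 2 ≤ bracket (x + z) := by
  have := bracket_add_le (x + z) (-z)
  rw [add_neg_cancel_right, norm_neg] at this
  linarith

/-- The ratio `⟨x + z⟩² / ⟨x⟩²`, whose power `-β/2` is `ψ_β (x + z) / ψ_β x`. -/
def bracketRatio (x z : E) : ℝ := bracket (x + z) ^ 2 / bracket x ^ 2

lemma quarter_le_bracketRatio {x z : E} (hz : ‖z‖ ≤ bracket x / 2) :
    1 / 4 ≤ bracketRatio x z := by
  have := bracket_pos x
  rw [bracketRatio, le_div_iff₀ (by positivity)]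
  nlinarith [half_bracket_le hz]

end Bracket

section BracketRatio

variable {E : Type*} [NormedAddCommGroup E] [InnerProductSpace ℝ E]

lemma bracketRatio_sub_one (x z : E) :
    bracketRatio x z - 1 = (2 * inner ℝ x z + ‖z‖ ^ 2) / bracket x ^ 2 := by
  have := bracket_pos x
  rw [bracketRatio, div_sub_one (by positivity), bracket_sq, norm_add_sq_real, bracket_sq]
  ring

lemma two_le_bracketRatio_add_neg (x z : E) : 2 ≤ bracketRatio x z + bracketRatio x (-z) := by
  have hsum : (bracketRatio x z - 1) + (bracketRatio x (-z) - 1) =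
      2 * ‖z‖ ^ 2 / bracket x ^ 2 := by
    rw [bracketRatio_sub_one, bracketRatio_sub_one, inner_neg_right, norm_neg]; ring
  have : 0 ≤ 2 * ‖z‖ ^ 2 / bracket x ^ 2 := by positivity
  linarith

lemma abs_bracketRatio_sub_one_le {x z : E} (hz : ‖z‖ ≤ bracket x / 2) :
    |bracketRatio x z - 1| ≤ 5 / 2 * (‖z‖ / bracket x) := by
  have hx := bracket_pos x
  have hinner : |inner ℝ x z| ≤ bracket x * ‖z‖ :=
    (abs_real_inner_le_norm x z).trans (by gcongr; exact norm_le_bracket x)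
  rw [bracketRatio_sub_one, abs_div, abs_of_pos (pow_pos hx 2), div_le_iff₀ (pow_pos hx 2)]
  calc |2 * inner ℝ x z + ‖z‖ ^ 2| ≤ 2 * |inner ℝ x z| + ‖z‖ ^ 2 := by
        refine (abs_add_le _ _).trans_eq ?_
        rw [abs_mul, abs_two, abs_of_nonneg (sq_nonneg ‖z‖)]
    _ ≤ 2 * (bracket x * ‖z‖) + bracket x / 2 * ‖z‖ := by rw [sq]; gcongr
    _ = 5 / 2 * (‖z‖ / bracket x) * bracket x ^ 2 := by field_simp; ring

lemma sq_bracketRatio_sub_one_le {x z : E} (hz : ‖z‖ ≤ bracket x / 2) :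
    (bracketRatio x z - 1) ^ 2 ≤ 25 / 4 * (‖z‖ ^ 2 / bracket x ^ 2) := by
  calc (bracketRatio x z - 1) ^ 2 = |bracketRatio x z - 1| ^ 2 := (sq_abs _).symm
    _ ≤ (5 / 2 * (‖z‖ / bracket x)) ^ 2 := by gcongr; exact abs_bracketRatio_sub_one_le hz
    _ = _ := by ring

end BracketRatio

section NegPow

variable {a b r : ℝ}

lemma abs_rpow_neg_sub_one_le (ha : 0 < a) (ha1 : a ≤ 1) (hb : 0 ≤ b) (hr : a ≤ r) :
    |r ^ (-b) - 1| ≤ b * a ^ (-b - 1) * |r - 1| := by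
  have := (convex_Ici a).norm_image_sub_le_of_norm_hasDerivWithin_le
    (f := fun t : ℝ => t ^ (-b)) (f' := fun t => -b * t ^ (-b - 1))
    (C := b * a ^ (-b - 1)) (fun t ht => ?_) (fun t ht => ?_) (mem_Ici.2 ha1) (mem_Ici.2 hr)
  · simpa using this
  · exact (Real.hasDerivAt_rpow_const (Or.inl (ha.trans_le ht).ne')).hasDerivWithinAt
  · have ht0 : 0 < t := ha.trans_le ht
    rw [norm_mul, norm_neg, Real.norm_of_nonneg hb, Real.norm_of_nonneg (by positivity)]
    exact mul_le_mul_of_nonneg_left (Real.rpow_le_rpow_of_nonpos ha ht (by linarith)) hb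

lemma rpow_neg_le_taylor (ha : 0 < a) (ha1 : a ≤ 1) (hb : 0 ≤ b) (hr : a ≤ r) :
    r ^ (-b) ≤ 1 - b * (r - 1) + b * ((b + 1) * a ^ (-b - 2)) * (r - 1) ^ 2 := by
  set C := (b + 1) * a ^ (-b - 2) with hC
  have hsub : ∀ t ∈ uIcc 1 r, a ≤ t := fun t ht => (le_min ha1 hr).trans ht.1
  have := (convex_uIcc (1 : ℝ) r).norm_image_sub_le_of_norm_hasDerivWithin_le
    (f := fun t : ℝ => t ^ (-b) + b * t) (f' := fun t => -b * t ^ (-b - 1) + b)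
    (C := b * (C * |r - 1|)) (fun t ht => ?_) (fun t ht => ?_) left_mem_uIcc right_mem_uIcc
  · have h := (le_abs_self _).trans this
    rw [Real.norm_eq_abs, mul_assoc, mul_assoc, abs_mul_abs_self] at h
    simp only [Real.one_rpow, mul_one] at h
    linarith
  · have hpow := Real.hasDerivAt_rpow_const (p := -b) (Or.inl (ha.trans_le (hsub t ht)).ne')
    exact ((hpow.add ((hasDerivAt_id t).const_mul b)).congr_deriv (by simp)).hasDerivWithinAt
  · have h := abs_rpow_neg_sub_one_le ha ha1 (b := b + 1) (by linarith) (hsub t ht)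
    rw [neg_add', show -b - 1 - 1 = -b - 2 by ring, ← hC] at h
    rw [show -b * t ^ (-b - 1) + b = -(b * (t ^ (-b - 1) - 1)) by ring, norm_neg, norm_mul,
      Real.norm_of_nonneg hb, Real.norm_eq_abs]
    have hdist := abs_sub_left_of_mem_uIcc ht
    gcongr
    exact h.trans (by gcongr)

end NegPow

section Weight

variable {N : ℕ}

lemma psi_eq_bracket (β : ℝ) (x : Space N) : psi β x = bracket x ^ (-β) := by
  rw [psi, ← bracket_sq, ← Real.rpow_natCast, ← Real.rpow_mul (bracket_pos x).le]
  congr 1; push_cast; ring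

lemma psi_pos (β : ℝ) (x : Space N) : 0 < psi β x := by
  unfold psi; positivity

lemma continuous_psi (β : ℝ) : Continuous (psi β : Space N → ℝ) :=
  (by fun_prop : Continuous fun x : Space N => 1 + ‖x‖ ^ 2).rpow_const
    fun x => Or.inl (by positivity)

lemma psi_le_one {β : ℝ} (hβ : 0 ≤ β) (x : Space N) : psi β x ≤ 1 := by
  rw [psi_eq_bracket]
  exact Real.rpow_le_one_of_one_le_of_nonpos (one_le_bracket x) (by linarith)

lemma psi_le_psi_of_exponent_le {β β' : ℝ} (h : β ≤ β') (x : Space N) : psi β' x ≤ psi β x := by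
  simp only [psi_eq_bracket]
  exact Real.rpow_le_rpow_of_exponent_le (one_le_bracket x) (by linarith)

lemma psi_le_psi_of_norm_le {β : ℝ} (hβ : 0 ≤ β) {x y : Space N} (h : ‖x‖ ≤ ‖y‖) :
    psi β y ≤ psi β x :=
  Real.rpow_le_rpow_of_nonpos (by positivity) (by gcongr) (by linarith)

lemma psi_le_norm_rpow {β : ℝ} (hβ : 0 ≤ β) {x : Space N} (hx : x ≠ 0) :
    psi β x ≤ ‖x‖ ^ (-β) := by
  rw [psi_eq_bracket]
  exact Real.rpow_le_rpow_of_nonpos (norm_pos_iff.2 hx) (norm_le_bracket x) (by linarith)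

lemma psi_add_eq (β : ℝ) (x z : Space N) :
    psi β (x + z) = psi β x * bracketRatio x z ^ (-(β / 2)) := by
  have := bracket_pos x
  rw [bracketRatio, psi, psi, ← bracket_sq, ← bracket_sq,
    Real.div_rpow (by positivity) (by positivity), neg_div]
  field_simp

lemma exists_abs_psi_add_sub_le {β : ℝ} (hβ : 0 ≤ β) :
    ∃ C, 0 ≤ C ∧ ∀ x z : Space N, ‖z‖ ≤ bracket x / 2 →
      |psi β (x + z) - psi β x| ≤ C * psi β x * ‖z‖ := by
  set L := β / 2 * (1 / 4 : ℝ) ^ (-(β / 2) - 1)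
  refine ⟨5 / 2 * L, by positivity, fun x z hz => ?_⟩
  have hψ := (psi_pos β x).le
  calc |psi β (x + z) - psi β x| = psi β x * |bracketRatio x z ^ (-(β / 2)) - 1| := by
        rw [psi_add_eq, ← mul_sub_one, abs_mul, abs_of_nonneg hψ]
    _ ≤ psi β x * (L * |bracketRatio x z - 1|) := by
        gcongr
        exact abs_rpow_neg_sub_one_le (by norm_num) (by norm_num) (by positivity)
          (quarter_le_bracketRatio hz)
    _ ≤ psi β x * (L * (5 / 2 * ‖z‖)) := by
        gcongr
        refine (abs_bracketRatio_sub_one_le hz).trans ?_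
        gcongr
        exact div_le_self (norm_nonneg z) (one_le_bracket x)
    _ = 5 / 2 * L * psi β x * ‖z‖ := by ring

lemma exists_psi_second_difference_le {β : ℝ} (hβ : 0 ≤ β) :
    ∃ C, 0 ≤ C ∧ ∀ x z : Space N, ‖z‖ ≤ bracket x / 2 →
      psi β (x + z) + psi β (x - z) - 2 * psi β x ≤
        C * psi β x * bracket x ^ (-2 : ℝ) * ‖z‖ ^ 2 := by
  set Q := β / 2 * ((β / 2 + 1) * (1 / 4 : ℝ) ^ (-(β / 2) - 2))
  have : 0 ≤ Q := by positivity
  refine ⟨25 / 2 * Q, by positivity, fun x z hz => ?_⟩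
  have hψ := (psi_pos β x).le
  have taylor : ∀ w : Space N, ‖w‖ ≤ bracket x / 2 → bracketRatio x w ^ (-(β / 2)) ≤
      1 - β / 2 * (bracketRatio x w - 1) + Q * (25 / 4 * (‖w‖ ^ 2 / bracket x ^ 2)) := by
    intro w hw
    refine (rpow_neg_le_taylor (by norm_num) (by norm_num) (by positivity)
      (quarter_le_bracketRatio hw)).trans ?_
    gcongr
    exact sq_bracketRatio_sub_one_le hw
  have hz' := taylor (-z) (by rwa [norm_neg])
  rw [norm_neg] at hz'
  calc psi β (x + z) + psi β (x - z) - 2 * psi β x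
      = psi β x * (bracketRatio x z ^ (-(β / 2)) + bracketRatio x (-z) ^ (-(β / 2)) - 2) := by
        rw [psi_add_eq, sub_eq_add_neg x z, psi_add_eq]; ring
    _ ≤ psi β x * (25 / 2 * Q * (‖z‖ ^ 2 / bracket x ^ 2)) := by
        gcongr
        nlinarith [taylor z hz, two_le_bracketRatio_add_neg x z]
    _ = _ := by
        rw [Real.rpow_neg (bracket_pos x).le, Real.rpow_two]; ring

lemma div_rpow_neg {a c : ℝ} (ha : 0 ≤ a) (hc : 0 ≤ c) (b : ℝ) :
    (a / c) ^ (-b) = c ^ b * a ^ (-b) := by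
  rw [Real.div_rpow ha hc, Real.rpow_neg hc, div_inv_eq_mul, mul_comm]

/-- If `|z| ≤ ⟨x⟩/2`, then `⟨x + z⟩` is comparable to `⟨x⟩`; otherwise `|z|` controls both. -/
lemma exists_psi_mul_rpow_le {β ν : ℝ} (hβ : 0 ≤ β) (hβν : β ≤ ν) :
    ∃ C, 0 ≤ C ∧ ∀ x z : Space N, z ≠ 0 →
      psi β (x + z) * ‖z‖ ^ (-ν) ≤ C * psi β x * (‖z‖ ^ (-ν) + psi ν (x + z)) := by
  refine ⟨2 ^ β + 2 ^ β * 3 ^ (ν - β), by positivity, fun x z hz => ?_⟩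
  have hz0 : 0 < ‖z‖ := norm_pos_iff.2 hz
  simp only [psi_eq_bracket]
  have hX := bracket_pos x
  have hY := bracket_pos (x + z)
  have hXYz := bracket_add_le x z
  rcases le_total ‖z‖ (bracket x / 2) with hnear | hfar
  · have hYX := half_bracket_le hnear
    set X := bracket x
    set Y := bracket (x + z)
    have hYβ : Y ^ (-β) ≤ (X / 2) ^ (-β) :=
      Real.rpow_le_rpow_of_nonpos (by positivity) hYX (by linarith)
    calc Y ^ (-β) * ‖z‖ ^ (-ν) ≤ (X / 2) ^ (-β) * ‖z‖ ^ (-ν) := by gcongr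
      _ = 2 ^ β * X ^ (-β) * ‖z‖ ^ (-ν) := by rw [div_rpow_neg hX.le two_pos.le]
      _ ≤ _ := by
        gcongr <;> exact le_add_of_nonneg_right (by positivity)
  · set X := bracket x
    set Y := bracket (x + z)
    have hzX : ‖z‖ ^ (-β) ≤ (X / 2) ^ (-β) :=
      Real.rpow_le_rpow_of_nonpos (by positivity) hfar (by linarith)
    have hzY : ‖z‖ ^ (-(ν - β)) ≤ (Y / 3) ^ (-(ν - β)) :=
      Real.rpow_le_rpow_of_nonpos (by positivity) (by linarith) (by linarith)
    calc Y ^ (-β) * ‖z‖ ^ (-ν) = Y ^ (-β) * (‖z‖ ^ (-β) * ‖z‖ ^ (-(ν - β))) := by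
          rw [← Real.rpow_add hz0]; ring_nf
      _ ≤ Y ^ (-β) * ((X / 2) ^ (-β) * (Y / 3) ^ (-(ν - β))) := by gcongr
      _ = 2 ^ β * 3 ^ (ν - β) * X ^ (-β) * (Y ^ (-β) * Y ^ (-(ν - β))) := by
          rw [div_rpow_neg hX.le two_pos.le, div_rpow_neg hY.le (by norm_num)]; ring
      _ = 2 ^ β * 3 ^ (ν - β) * X ^ (-β) * Y ^ (-ν) := by
          rw [← Real.rpow_add hY]; ring_nf
      _ ≤ _ := by
        gcongr <;> exact le_add_of_nonneg_left (by positivity)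

end Weight

/-! ### Truncated kernels -/

section Kern

variable {E : Type*} [NormedAddCommGroup E]

/-- The kernel `|z|^(-ν)` truncated to `|z| ≥ ε`; the fractional Laplacian has `ν = N + 2s`. -/
def kern (ν ε : ℝ) : E → ℝ := indicator {z | ε ≤ ‖z‖} fun z => ‖z‖ ^ (-ν)

lemma measurable_kern [MeasurableSpace E] [OpensMeasurableSpace E] (ν ε : ℝ) :
    Measurable (kern ν ε : E → ℝ) :=
  Measurable.indicator (by fun_prop) (measurableSet_le measurable_const measurable_norm)

lemma kern_nonneg (ν ε : ℝ) (z : E) : 0 ≤ kern ν ε z :=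
  indicator_nonneg (fun _ _ => by positivity) z

lemma kern_neg (ν ε : ℝ) (z : E) : kern ν ε (-z) = kern ν ε z := by
  simp [kern, indicator]

lemma kern_of_le {ν ε : ℝ} {z : E} (h : ε ≤ ‖z‖) : kern ν ε z = ‖z‖ ^ (-ν) :=
  indicator_of_mem (s := {z : E | ε ≤ ‖z‖}) h _

lemma kern_of_lt {ν ε : ℝ} {z : E} (h : ‖z‖ < ε) : kern ν ε z = 0 :=
  indicator_of_notMem (s := {z : E | ε ≤ ‖z‖}) (not_le.2 h) _

lemma kern_le_rpow (ν ε : ℝ) (z : E) : kern ν ε z ≤ ‖z‖ ^ (-ν) :=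
  indicator_le_self' (fun _ _ => by positivity) z

lemma sq_mul_kern_le (ν ε : ℝ) (z : E) : ‖z‖ ^ 2 * kern ν ε z ≤ ‖z‖ ^ (2 - ν) := by
  rcases eq_or_ne z 0 with rfl | hz
  · simp only [norm_zero, ne_eq, two_ne_zero, not_false_eq_true, zero_pow, zero_mul]
    positivity
  · rw [sub_eq_add_neg, Real.rpow_add (norm_pos_iff.2 hz), Real.rpow_two]
    gcongr
    exact kern_le_rpow ν ε z

lemma kern_sub_le {ν ε : ℝ} (hν : 0 ≤ ν) (hε : 0 < ε) (x y : E) :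
    kern ν ε (y - x) ≤ ((1 + ‖x‖) / ε + 1) ^ ν * (1 + ‖y‖) ^ (-ν) := by
  rcases lt_or_ge ‖y - x‖ ε with h | h
  · rw [kern_of_lt h]; positivity
  have : 0 < ‖y - x‖ := hε.trans_le h
  set A := (1 + ‖x‖) / ε + 1 with hA
  have hle : 1 + ‖y‖ ≤ A * ‖y - x‖ := by
    have hy : ‖y‖ ≤ ‖x‖ + ‖y - x‖ := by simpa using norm_add_le x (y - x)
    have hx : 1 + ‖x‖ ≤ (1 + ‖x‖) / ε * ‖y - x‖ := by
      rw [div_mul_eq_mul_div, le_div_iff₀ hε]; gcongr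
    rw [hA, add_mul]; linarith
  calc kern ν ε (y - x) = ‖y - x‖ ^ (-ν) := kern_of_le h
    _ ≤ ((1 + ‖y‖) / A) ^ (-ν) :=
        Real.rpow_le_rpow_of_nonpos (by positivity) ((div_le_iff₀' (by positivity)).2 hle)
          (by linarith)
    _ = A ^ ν * (1 + ‖y‖) ^ (-ν) := div_rpow_neg (by positivity) (by positivity) ν

end Kern

lemma integral_le_of_add_neg_le {E : Type*} [AddCommGroup E] [MeasurableSpace E]
    [MeasurableNeg E] {μ : Measure E} [μ.IsNegInvariant] {f g : E → ℝ}
    (hf : Integrable f μ) (hg : Integrable g μ) (h : ∀ z, f z + f (-z) ≤ g z) :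
    ∫ z, f z ∂μ ≤ (∫ z, g z ∂μ) / 2 := by
  have hsymm : ∫ z, (f z + f (-z)) ∂μ = 2 * ∫ z, f z ∂μ := by
    rw [integral_add hf hf.comp_neg, integral_neg_eq_self f μ]; ring
  have hmono : ∫ z, (f z + f (-z)) ∂μ ≤ ∫ z, g z ∂μ := integral_mono (hf.add hf.comp_neg) hg h
  linarith

section Nonlocal

variable {N : ℕ}

lemma finrank_space : Module.finrank ℝ (Space N) = N := finrank_euclideanSpace_fin

lemma nontrivial_space (hN : 1 ≤ N) : Nontrivial (Space N) :=
  Module.nontrivial_of_finrank_pos (R := ℝ) (by rwa [finrank_space])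

lemma integrable_one_add_norm_rpow {ν : ℝ} (hν : N < ν) :
    Integrable fun y : Space N => (1 + ‖y‖) ^ (-ν) :=
  integrable_one_add_norm (by rwa [finrank_space])

lemma integrable_psi {ν : ℝ} (hν : N < ν) : Integrable (psi ν : Space N → ℝ) :=
  integrable_rpow_neg_one_add_norm_sq (by rwa [finrank_space])

lemma integrable_kern {ν ε : ℝ} (hν : N < ν) (hε : 0 < ε) :
    Integrable (kern ν ε : Space N → ℝ) := by
  refine ((integrable_one_add_norm_rpow hν).const_mul (((1 + ‖(0 : Space N)‖) / ε + 1) ^ ν)).mono'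
    (measurable_kern ν ε).aestronglyMeasurable (ae_of_all _ fun y => ?_)
  rw [Real.norm_of_nonneg (kern_nonneg _ _ _)]
  simpa only [sub_zero] using kern_sub_le ((Nat.cast_nonneg N).trans hν.le) hε 0 y

lemma integrableOn_ball_norm_rpow (hN : 1 ≤ N) {a : ℝ} (ha : -N < a) (r : ℝ) :
    IntegrableOn (fun z : Space N => ‖z‖ ^ a) (ball 0 r) := by
  refine integrableOn_ball_of_norm_le_rpow (C := 1) (α := -a) (by rwa [finrank_space])
    (by rw [finrank_space]; linarith) (ae_of_all _ fun z => ?_)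
    (by fun_prop : Measurable fun z : Space N => ‖z‖ ^ a).aestronglyMeasurable
  rw [Real.norm_of_nonneg (by positivity), neg_neg, one_mul]

lemma setIntegral_ball_norm_rpow (a : ℝ) {r : ℝ} (hr : 0 < r) :
    ∫ z in ball (0 : Space N) r, ‖z‖ ^ a =
      r ^ (N + a) * ∫ z in ball (0 : Space N) 1, ‖z‖ ^ a := by
  have h := Measure.setIntegral_comp_smul_of_pos (volume : Measure (Space N))
    (fun z : Space N => ‖z‖ ^ a) (ball (0 : Space N) 1) hr
  rw [smul_unitBall_of_pos hr, finrank_space] at h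
  simp only [norm_smul, Real.norm_of_nonneg hr.le, Real.mul_rpow hr.le (norm_nonneg _),
    integral_const_mul, smul_eq_mul] at h
  rw [Real.rpow_add hr, Real.rpow_natCast, mul_assoc, h]
  field_simp

/-- The truncated nonlocal operator `∫_{|z| ≥ ε} (f x - f (x + z)) |z|^(-ν) dz`; for `ν = N + 2s`
its limit as `ε → 0` is `(-Δ)^s f x` up to the factor `C_{N,s}`. -/
def nonlocal (ν ε : ℝ) (f : Space N → ℝ) (x : Space N) : ℝ :=
  ∫ z, (f x - f (x + z)) * kern ν ε z

lemma neg_nonlocal (ν ε : ℝ) (f : Space N → ℝ) (x : Space N) :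
    -nonlocal ν ε f x = ∫ z, (f (x + z) - f x) * kern ν ε z := by
  rw [nonlocal, ← integral_neg]
  simp only [← neg_mul, neg_sub]

lemma integrable_sub_mul_kern_of_bounded {ν ε B : ℝ} (hν : N < ν) (hε : 0 < ε)
    {f : Space N → ℝ} (hf : Continuous f) (hB : ∀ y, |f y| ≤ B) (x : Space N) :
    Integrable fun z => (f (x + z) - f x) * kern ν ε z := by
  refine (integrable_kern hν hε).bdd_mul (c := B + B) (by fun_prop) (ae_of_all _ fun z => ?_)
  exact (norm_sub_le _ _).trans (add_le_add (hB _) (hB _))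

lemma setIntegral_ball_kern_le (hN : 1 ≤ N) {ν ε r A : ℝ} (hν : ν < N + 2) (hr : 0 < r)
    (hA : 0 ≤ A) {f : Space N → ℝ} {x : Space N}
    (hint : IntegrableOn (fun z => (f (x + z) - f x) * kern ν ε z) (ball 0 r))
    (hf : ∀ z, ‖z‖ < r → f (x + z) + f (x - z) - 2 * f x ≤ A * ‖z‖ ^ 2) :
    ∫ z in ball 0 r, (f (x + z) - f x) * kern ν ε z ≤
      A * r ^ (N + 2 - ν) * ∫ z in ball (0 : Space N) 1, ‖z‖ ^ (2 - ν) := by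
  have hpow := (integrableOn_ball_norm_rpow hN (a := 2 - ν) (by linarith) r).const_mul A
  rw [← integrable_indicator_iff measurableSet_ball] at hint
  have hle := integral_le_of_add_neg_le hint
    (IntegrableOn.integrable_indicator hpow measurableSet_ball) fun z => ?_
  · rw [integral_indicator measurableSet_ball, integral_indicator measurableSet_ball,
      integral_const_mul] at hle
    have : 0 ≤ A * ∫ z in ball (0 : Space N) r, ‖z‖ ^ (2 - ν) :=
      mul_nonneg hA (integral_nonneg fun z => by positivity)
    rw [mul_assoc, show (N : ℝ) + 2 - ν = N + (2 - ν) by ring, ← setIntegral_ball_norm_rpow _ hr]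
    linarith
  · by_cases hz : ‖z‖ < r
    · have hmem : z ∈ ball (0 : Space N) r := mem_ball_zero_iff.2 hz
      have hmem' : -z ∈ ball (0 : Space N) r := by rwa [mem_ball_zero_iff, norm_neg]
      rw [indicator_of_mem hmem, indicator_of_mem hmem', indicator_of_mem hmem, kern_neg,
        ← sub_eq_add_neg]
      calc (f (x + z) - f x) * kern ν ε z + (f (x - z) - f x) * kern ν ε z
          = (f (x + z) + f (x - z) - 2 * f x) * kern ν ε z := by ring
        _ ≤ A * ‖z‖ ^ 2 * kern ν ε z := by gcongr; exacts [kern_nonneg ν ε z, hf z hz]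
        _ = A * (‖z‖ ^ 2 * kern ν ε z) := mul_assoc _ _ _
        _ ≤ A * ‖z‖ ^ (2 - ν) := by gcongr; exact sq_mul_kern_le ν ε z
    · have hmem : z ∉ ball (0 : Space N) r := by rwa [mem_ball_zero_iff]
      have hmem' : -z ∉ ball (0 : Space N) r := by rwa [mem_ball_zero_iff, norm_neg]
      simp only [indicator_of_notMem hmem, indicator_of_notMem hmem', add_zero, le_refl]

end Nonlocal

/-! ### The nonlocal operator applied to the weight -/

section NonlocalWeight

variable {N : ℕ} {ν α β : ℝ}

lemma integrable_psi_sub_mul_kern {ε : ℝ} (hν : N < ν) (hβ : 0 ≤ β) (hε : 0 < ε) (x : Space N) :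
    Integrable fun z => (psi β (x + z) - psi β x) * kern ν ε z :=
  integrable_sub_mul_kern_of_bounded hν hε (continuous_psi β)
    (fun y => (abs_of_pos (psi_pos β y)).trans_le (psi_le_one hβ y)) x

lemma integrableOn_psi_ball (β r : ℝ) : IntegrableOn (psi β : Space N → ℝ) (ball 0 r) :=
  ((continuous_psi β).continuousOn.integrableOn_compact (isCompact_closedBall 0 r)).mono_set
    ball_subset_closedBall

lemma exists_setIntegral_psi_near_le (hN : 1 ≤ N) (hν : N < ν) (hν' : ν < N + 2) (hβ : 0 ≤ β)
    (hα : α ≤ ν - N) :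
    ∃ C, 0 ≤ C ∧ ∀ ε, 0 < ε → ∀ x : Space N,
      ∫ z in ball 0 (bracket x / 2), (psi β (x + z) - psi β x) * kern ν ε z ≤
        C * bracket x ^ (-α) * psi β x := by
  obtain ⟨C, hC, hdiff⟩ := exists_psi_second_difference_le (N := N) hβ
  set c := ∫ z in ball (0 : Space N) 1, ‖z‖ ^ (2 - ν)
  have : 0 ≤ c := integral_nonneg fun z => by positivity
  refine ⟨C * c, by positivity, fun ε hε x => ?_⟩
  have hx := bracket_pos x
  have hψ := psi_pos β x
  calc ∫ z in ball 0 (bracket x / 2), (psi β (x + z) - psi β x) * kern ν ε z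
      ≤ C * psi β x * bracket x ^ (-2 : ℝ) * (bracket x / 2) ^ (N + 2 - ν) * c :=
        setIntegral_ball_kern_le hN hν' (by positivity) (by positivity)
          (integrable_psi_sub_mul_kern hν hβ hε x).integrableOn fun z hz => hdiff x z hz.le
    _ ≤ C * psi β x * bracket x ^ (-2 : ℝ) * bracket x ^ (N + 2 - ν) * c := by
        have : 0 ≤ N + 2 - ν := by linarith
        gcongr
        exact half_le_self hx.le
    _ = C * psi β x * bracket x ^ (N - ν) * c := by
        rw [mul_assoc (C * psi β x), ← Real.rpow_add hx]; congr 3; ring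
    _ ≤ C * psi β x * bracket x ^ (-α) * c := by
        gcongr
        exacts [one_le_bracket x, by linarith]
    _ = C * c * bracket x ^ (-α) * psi β x := by ring

/-- Only the points `y` with `|y| < |x|` have `ψ_β y > ψ_β x`. -/
lemma setIntegral_psi_far_le (hν : N < ν) (hβ : 0 ≤ β) {ε : ℝ} (hε : 0 < ε) (x : Space N) :
    ∫ z in (ball 0 (bracket x / 2))ᶜ, (psi β (x + z) - psi β x) * kern ν ε z ≤
      2 ^ ν * bracket x ^ (-ν) * ∫ y in ball (0 : Space N) ‖x‖, psi β y := by
  have hx := bracket_pos x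
  set r := bracket x / 2 with hr
  set g : Space N → ℝ := (ball 0 ‖x‖).indicator (psi β) with hg
  have hgi : Integrable g := (integrableOn_psi_ball β ‖x‖).integrable_indicator measurableSet_ball
  have hg0 : ∀ y, 0 ≤ g y := indicator_nonneg fun y _ => (psi_pos β y).le
  have hgx : Integrable fun z => g (x + z) * r ^ (-ν) := (hgi.comp_add_left x).mul_const _
  have hsub : ∀ y, psi β y - psi β x ≤ g y := fun y => by
    by_cases hy : y ∈ ball 0 ‖x‖
    · rw [hg, indicator_of_mem hy]; linarith [psi_pos β x]
    · rw [hg, indicator_of_notMem hy]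
      rw [mem_ball_zero_iff, not_lt] at hy
      linarith [psi_le_psi_of_norm_le hβ hy]
  calc ∫ z in (ball 0 r)ᶜ, (psi β (x + z) - psi β x) * kern ν ε z
      ≤ ∫ z in (ball 0 r)ᶜ, g (x + z) * r ^ (-ν) := by
        refine setIntegral_mono_on (integrable_psi_sub_mul_kern hν hβ hε x).integrableOn
          hgx.integrableOn measurableSet_ball.compl fun z hz => ?_
        rw [mem_compl_iff, mem_ball_zero_iff, not_lt] at hz
        have hk : kern ν ε z ≤ r ^ (-ν) := (kern_le_rpow ν ε z).trans
          (Real.rpow_le_rpow_of_nonpos (by positivity) hz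
            (neg_nonpos.2 ((Nat.cast_nonneg N).trans hν.le)))
        exact (mul_le_mul_of_nonneg_right (hsub _) (kern_nonneg ν ε z)).trans
          (mul_le_mul_of_nonneg_left hk (hg0 _))
    _ ≤ ∫ z, g (x + z) * r ^ (-ν) :=
        setIntegral_le_integral hgx (ae_of_all _ fun z => mul_nonneg (hg0 _) (by positivity))
    _ = r ^ (-ν) * ∫ y in ball (0 : Space N) ‖x‖, psi β y := by
        rw [integral_mul_const, integral_add_left_eq_self g x, hg,
          integral_indicator measurableSet_ball, mul_comm]
    _ = _ := by rw [hr, div_rpow_neg hx.le two_pos.le]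

lemma exists_neg_nonlocal_psi_le (hN : 1 ≤ N) {M : ℝ} (hν : N < ν) (hν' : ν < N + 2)
    (hβ : 0 ≤ β) (hα : α ≤ ν - N) (hM0 : 0 ≤ M)
    (hM : ∀ x : Space N, ∫ y in ball (0 : Space N) ‖x‖, psi β y ≤ M * bracket x ^ (ν - α - β)) :
    ∃ C, 0 ≤ C ∧ ∀ ε, 0 < ε → ∀ x : Space N,
      -nonlocal ν ε (psi β) x ≤ C * bracket x ^ (-α) * psi β x := by
  obtain ⟨C, hC0, hnear⟩ := exists_setIntegral_psi_near_le (α := α) hN hν hν' hβ hα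
  refine ⟨C + 2 ^ ν * M, by positivity, fun ε hε x => ?_⟩
  have hx := bracket_pos x
  have hfar := calc
    ∫ z in (ball 0 (bracket x / 2))ᶜ, (psi β (x + z) - psi β x) * kern ν ε z
      ≤ 2 ^ ν * bracket x ^ (-ν) * (M * bracket x ^ (ν - α - β)) :=
        (setIntegral_psi_far_le hν hβ hε x).trans (by gcongr; exact hM x)
    _ = 2 ^ ν * M * (bracket x ^ (-ν) * bracket x ^ (ν - α - β)) := by ring
    _ = 2 ^ ν * M * bracket x ^ (-α) * psi β x := by
        rw [psi_eq_bracket, mul_assoc (2 ^ ν * M), ← Real.rpow_add hx, ← Real.rpow_add hx]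
        congr 2; ring
  rw [neg_nonlocal, ← integral_add_compl measurableSet_ball
    (integrable_psi_sub_mul_kern hν hβ hε x) (s := ball 0 (bracket x / 2))]
  linarith [hnear ε hε x]

lemma exists_neg_nonlocal_psi_le_of_lt_dim (hN : 1 ≤ N) (hν : N < ν) (hν' : ν < N + 2)
    (hβ : 0 < β) (hβN : β < N) (hα : α ≤ ν - N) :
    ∃ C, 0 ≤ C ∧ ∀ ε, 0 < ε → ∀ x : Space N,
      -nonlocal ν ε (psi β) x ≤ C * bracket x ^ (-α) * psi β x := by
  refine exists_neg_nonlocal_psi_le hN hν hν' hβ.le hα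
    (M := ∫ z in ball (0 : Space N) 1, ‖z‖ ^ (-β))
    (integral_nonneg fun z => by positivity) fun x => ?_
  have := nontrivial_space hN
  calc ∫ y in ball (0 : Space N) ‖x‖, psi β y ≤ ∫ y in ball (0 : Space N) (bracket x), psi β y :=
        setIntegral_mono_set (integrableOn_psi_ball β _) (ae_of_all _ fun y => (psi_pos β y).le)
          (ball_subset_ball (norm_le_bracket x)).eventuallyLE
    _ ≤ ∫ y in ball (0 : Space N) (bracket x), ‖y‖ ^ (-β) := by
        refine integral_mono_ae (integrableOn_psi_ball β _)
          (integrableOn_ball_norm_rpow hN (by linarith) _) ?_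
        filter_upwards [ae_restrict_of_ae (Measure.ae_ne volume (0 : Space N))] with y hy
        exact psi_le_norm_rpow hβ.le hy
    _ = (∫ z in ball (0 : Space N) 1, ‖z‖ ^ (-β)) * bracket x ^ (N + -β) := by
        rw [setIntegral_ball_norm_rpow _ (bracket_pos x), mul_comm]
    _ ≤ _ := by
        gcongr
        exacts [one_le_bracket x, by linarith]

lemma exists_neg_nonlocal_psi_le_of_dim_lt (hN : 1 ≤ N) (hν' : ν < N + 2) (hβN : N < β)
    (hα : 0 ≤ α) (hαβ : α + β ≤ ν) :
    ∃ C, 0 ≤ C ∧ ∀ ε, 0 < ε → ∀ x : Space N,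
      -nonlocal ν ε (psi β) x ≤ C * bracket x ^ (-α) * psi β x := by
  have := Nat.cast_nonneg (α := ℝ) N
  have hmass : 0 ≤ ∫ z : Space N, psi β z := integral_nonneg fun z => (psi_pos β z).le
  refine exists_neg_nonlocal_psi_le hN (by linarith) hν' (by linarith) (by linarith) hmass
    fun x => ?_
  calc ∫ y in ball (0 : Space N) ‖x‖, psi β y ≤ ∫ y : Space N, psi β y :=
        setIntegral_le_integral (integrable_psi hβN) (ae_of_all _ fun y => (psi_pos β y).le)
    _ ≤ (∫ y : Space N, psi β y) * bracket x ^ (ν - α - β) :=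
        le_mul_of_one_le_right hmass (Real.one_le_rpow (one_le_bracket x) (by linarith))

end NonlocalWeight

/-! ### Superharmonicity of the critical weight -/

/-- The bathtub principle. -/
lemma setIntegral_le_setIntegral_of_measureReal_eq {X : Type*} [MeasurableSpace X] {μ : Measure X}
    {s t : Set X} (hs : MeasurableSet s) (ht : MeasurableSet t) (hμs : μ s ≠ ∞) (hμt : μ t ≠ ∞)
    (hμ : μ.real s = μ.real t) {f : X → ℝ} (hfs : IntegrableOn f s μ) (hft : IntegrableOn f t μ)
    {c : ℝ} (hout : ∀ x ∈ s \ t, f x ≤ c) (hin : ∀ x ∈ t, c ≤ f x) :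
    ∫ x in s, f x ∂μ ≤ ∫ x in t, f x ∂μ := by
  have hle : s.indicator (fun x => f x - c) ≤ t.indicator fun x => f x - c := fun x => by
    by_cases hxt : x ∈ t
    · rw [indicator_of_mem hxt]
      exact indicator_le' (fun _ _ => le_rfl) (fun _ _ => sub_nonneg.2 (hin x hxt)) x
    · rw [indicator_of_notMem hxt]
      by_cases hxs : x ∈ s
      · rw [indicator_of_mem hxs]; exact sub_nonpos.2 (hout x ⟨hxs, hxt⟩)
      · rw [indicator_of_notMem hxs]
  have hcs := integrableOn_const (C := c) hμs
  have hct := integrableOn_const (C := c) hμt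
  have hint := integral_mono ((hfs.sub hcs).integrable_indicator hs)
    ((hft.sub hct).integrable_indicator ht) hle
  rw [integral_indicator hs, integral_indicator ht, integral_sub' hfs hcs, integral_sub' hft hct,
    setIntegral_const, setIntegral_const, hμ] at hint
  linarith

section Inversion

open EuclideanGeometry Module

variable {E : Type*} [NormedAddCommGroup E] [InnerProductSpace ℝ E]

lemma inversion_zero_eq_smul (R : ℝ) (w : E) : inversion 0 R w = (R / ‖w‖) ^ 2 • w := by
  simp [inversion]

lemma norm_inversion_zero (R : ℝ) (w : E) : ‖inversion 0 R w‖ = R ^ 2 / ‖w‖ := by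
  simpa only [dist_zero_right] using dist_inversion_center (0 : E) w R

lemma image_inversion_closedBall_diff {R ε : ℝ} (hR : 0 < R) (hε : 0 < ε) :
    inversion 0 R '' (closedBall (0 : E) (R ^ 2 / ε) \ {0}) = {z : E | ε ≤ ‖z‖} := by
  have hinv := (inversion_involutive (0 : E) hR.ne').leftInverse
  rw [image_eq_preimage_of_inverse hinv hinv]
  ext z
  rw [mem_preimage, Set.mem_sdiff, mem_closedBall_zero_iff, norm_inversion_zero, mem_singleton_iff,
    inversion_eq_center hR.ne', mem_ofPred_eq]
  constructor
  · rintro ⟨hz, hz0⟩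
    exact (div_le_div_iff_of_pos_left (by positivity) (norm_pos_iff.2 hz0) hε).1 hz
  · intro hz
    exact ⟨by gcongr, norm_pos_iff.1 (hε.trans_le hz)⟩

lemma setIntegral_inversion [FiniteDimensional ℝ E] [MeasurableSpace E] [BorelSpace E] {R ε : ℝ}
    (hR : 0 < R) (hε : 0 < ε) (g : E → ℝ) :
    ∫ z in {z : E | ε ≤ ‖z‖}, g z =
      ∫ w in closedBall (0 : E) (R ^ 2 / ε) \ {0},
        ((R / ‖w‖) ^ 2) ^ finrank ℝ E * g (inversion 0 R w) := by
  have hS : MeasurableSet (closedBall (0 : E) (R ^ 2 / ε) \ {0}) :=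
    measurableSet_closedBall.diff (measurableSet_singleton 0)
  rw [← image_inversion_closedBall_diff hR hε,
    integral_image_eq_integral_abs_det_fderiv_smul volume hS
      (fun w hw => (hasFDerivAt_inversion hw.2).hasFDerivWithinAt)
      (inversion_injective _ hR.ne').injOn]
  refine setIntegral_congr_fun hS fun w _ => ?_
  have hdet : |LinearMap.det ((ℝ ∙ (w - 0))ᗮ.reflection.toLinearMap)| = 1 := by
    rw [Submodule.det_reflection, abs_pow, abs_neg, abs_one, one_pow]
  have hJ : |((R / dist w 0) ^ 2 • ((ℝ ∙ (w - 0))ᗮ.reflection : E →L[ℝ] E)).det| =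
      ((R / ‖w‖) ^ 2) ^ finrank ℝ E := by
    rw [ContinuousLinearMap.det, ContinuousLinearMap.toLinearMap_smul, LinearMap.det_smul, abs_mul,
      dist_zero_right, abs_of_nonneg (by positivity)]
    exact (congrArg _ hdet).trans (mul_one _)
  simp only [hJ, smul_eq_mul]

lemma bracket_add_inversion (x : E) {w : E} (hw : w ≠ 0) :
    bracket (x + inversion 0 (bracket x) w) = bracket x / ‖w‖ * bracket (x + w) := by
  have hx := bracket_pos x
  have : 0 < ‖w‖ := norm_pos_iff.2 hw
  refine (pow_left_inj₀ (bracket_pos _).le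
    (mul_nonneg (by positivity) (bracket_pos _).le) two_ne_zero).1 ?_
  rw [mul_pow, bracket_sq, bracket_sq, norm_add_sq_real, norm_add_sq_real, norm_inversion_zero,
    inversion_zero_eq_smul, inner_smul_right]
  have hsq := bracket_sq x
  generalize bracket x = R at *
  field_simp
  linear_combination (R ^ 2 - ‖w‖ ^ 2) * hsq

end Inversion

lemma inversion_rpow_identity {R t Y β ν : ℝ} {n : ℕ} (hR : 0 < R) (ht : 0 < t) (hY : 0 < Y)
    (h : β + ν = 2 * n) :
    ((R / t) ^ 2) ^ n * ((R ^ (-β) - (R / t * Y) ^ (-β)) * (R ^ 2 / t) ^ (-ν)) =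
      R ^ (-ν) * (t ^ (-β) - Y ^ (-β)) := by
  have hR' : R ^ (-β) = (R / t) ^ (-β) * t ^ (-β) := by
    rw [← Real.mul_rpow (by positivity) ht.le, div_mul_cancel₀ _ ht.ne']
  have hRt : R ^ 2 / t = R * (R / t) := by ring
  rw [hRt, hR']
  set q := R / t
  have hq : 0 < q := div_pos hR ht
  have hcancel : (q ^ 2) ^ n * (q ^ (-β) * q ^ (-ν)) = 1 := by
    rw [← pow_mul, ← Real.rpow_natCast q, ← Real.rpow_add hq, ← Real.rpow_add hq]
    push_cast
    rw [show (2 * n + (-β + -ν) : ℝ) = 0 by linarith, Real.rpow_zero]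
  rw [Real.mul_rpow hq.le hY.le, Real.mul_rpow hR.le hq.le]
  linear_combination R ^ (-ν) * (t ^ (-β) - Y ^ (-β)) * hcancel

section Critical

open EuclideanGeometry

variable {N : ℕ} {ν β : ℝ}

lemma setIntegral_psi_closedBall_le (hβ : 0 ≤ β) (x : Space N) (r : ℝ) :
    ∫ y in closedBall x r, psi β y ≤ ∫ y in closedBall (0 : Space N) r, psi β y := by
  have hint : ∀ y : Space N, IntegrableOn (psi β) (closedBall y r) := fun y =>
    (continuous_psi β).continuousOn.integrableOn_compact (isCompact_closedBall y r)
  refine setIntegral_le_setIntegral_of_measureReal_eq measurableSet_closedBall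
    measurableSet_closedBall measure_closedBall_lt_top.ne measure_closedBall_lt_top.ne
    (Measure.addHaar_real_closedBall_center volume x r) (hint x) (hint 0)
    (c := (1 + r ^ 2) ^ (-β / 2)) (fun y hy => ?_) (fun y hy => ?_)
  · have hr : 0 ≤ r := dist_nonneg.trans hy.1
    have hry : r ≤ ‖y‖ := by simpa using (not_le.1 (mem_closedBall_zero_iff.not.1 hy.2)).le
    exact Real.rpow_le_rpow_of_nonpos (by positivity) (by gcongr) (by linarith)
  · have hyr : ‖y‖ ≤ r := mem_closedBall_zero_iff.1 hy
    exact Real.rpow_le_rpow_of_nonpos (by positivity) (by gcongr) (by linarith)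

lemma setIntegral_norm_rpow_sub_psi_nonneg (hN : 1 ≤ N) (hβ : 0 ≤ β) (hβN : β < N)
    (x : Space N) (r : ℝ) :
    0 ≤ ∫ w in closedBall (0 : Space N) r, (‖w‖ ^ (-β) - psi β (x + w)) := by
  have hpow : IntegrableOn (fun w : Space N => ‖w‖ ^ (-β)) (closedBall 0 r) :=
    (integrableOn_ball_norm_rpow hN (by linarith) (r + 1)).mono_set
      (closedBall_subset_ball (by linarith))
  have hcomp : ∀ f : Space N → ℝ, Continuous f → IntegrableOn f (closedBall 0 r) := fun f hf =>
    hf.continuousOn.integrableOn_compact (isCompact_closedBall 0 r)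
  have hψ := continuous_psi (N := N) β
  have := nontrivial_space hN
  rw [integral_sub hpow (hcomp _ (by fun_prop)), sub_nonneg]
  calc ∫ w in closedBall (0 : Space N) r, psi β (x + w) = ∫ y in closedBall x r, psi β y := by
        rw [← (measurePreserving_add_left volume x).setIntegral_preimage_emb
          (measurableEmbedding_addLeft x) (psi β) (closedBall x r), preimage_add_closedBall,
          sub_self]
    _ ≤ ∫ y in closedBall (0 : Space N) r, psi β y := setIntegral_psi_closedBall_le hβ x r
    _ ≤ ∫ w in closedBall (0 : Space N) r, ‖w‖ ^ (-β) := by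
        refine integral_mono_ae (hcomp _ hψ) hpow ?_
        filter_upwards [ae_restrict_of_ae (Measure.ae_ne volume (0 : Space N))] with y hy
        exact psi_le_norm_rpow hβ hy

/-- Inversion in the sphere of radius `⟨x⟩` turns the tail integral into an integral over a
ball. -/
lemma nonlocal_psi_critical_eq {ε : ℝ} (hN : 1 ≤ N) (hβν : β + ν = 2 * N) (hε : 0 < ε)
    (x : Space N) :
    nonlocal ν ε (psi β) x =
      bracket x ^ (-ν) * ∫ w in closedBall (0 : Space N) (bracket x ^ 2 / ε),
        (‖w‖ ^ (-β) - psi β (x + w)) := by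
  set R := bracket x
  have hR : 0 < R := bracket_pos x
  have := nontrivial_space hN
  have htail : MeasurableSet {z : Space N | ε ≤ ‖z‖} :=
    measurableSet_le measurable_const measurable_norm
  have hS : MeasurableSet (closedBall (0 : Space N) (R ^ 2 / ε) \ {0}) :=
    measurableSet_closedBall.diff (measurableSet_singleton 0)
  calc nonlocal ν ε (psi β) x
      = ∫ z in {z : Space N | ε ≤ ‖z‖}, (psi β x - psi β (x + z)) * ‖z‖ ^ (-ν) := by
        rw [nonlocal, ← integral_indicator htail]
        simp only [kern, indicator_mul_right]
    _ = ∫ w in closedBall (0 : Space N) (R ^ 2 / ε) \ {0},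
          R ^ (-ν) * (‖w‖ ^ (-β) - psi β (x + w)) := by
        rw [setIntegral_inversion hR hε]
        refine setIntegral_congr_fun hS fun w hw => ?_
        have hw0 : w ≠ 0 := hw.2
        simp only [psi_eq_bracket, norm_inversion_zero, finrank_space]
        rw [bracket_add_inversion x hw0]
        exact inversion_rpow_identity hR (norm_pos_iff.2 hw0) (bracket_pos _) hβν
    _ = _ := by
        rw [integral_const_mul, setIntegral_congr_set (sdiff_null_ae_eq_self (measure_singleton _))]

lemma nonlocal_psi_critical_nonneg (hN : 1 ≤ N) {ε : ℝ} (hν : N < ν) (hβ : 0 ≤ β)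
    (hβν : β + ν = 2 * N) (hε : 0 < ε) (x : Space N) : 0 ≤ nonlocal ν ε (psi β) x := by
  have hx := bracket_pos x
  rw [nonlocal_psi_critical_eq hN hβν hε]
  exact mul_nonneg (by positivity)
    (setIntegral_norm_rpow_sub_psi_nonneg hN hβ (by linarith) x _)

end Critical

/-! ### Cut-off and test functions -/

lemma add_smul_mem_of_convex {E : Type*} [AddCommGroup E] [Module ℝ E] {s : Set E}
    (hs : Convex ℝ s) {x z : E} (hadd : x + z ∈ s) (hsub : x - z ∈ s) {τ : ℝ}
    (hτ : τ ∈ Icc (-1 : ℝ) 1) : x + τ • z ∈ s := by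
  have := hs hadd hsub (a := (1 + τ) / 2) (b := (1 - τ) / 2) (by linarith [hτ.1])
    (by linarith [hτ.2]) (by ring)
  convert this using 1
  module

lemma norm_second_difference_le {E F : Type*} [NormedAddCommGroup E] [NormedSpace ℝ E]
    [NormedAddCommGroup F] [NormedSpace ℝ F] {f : E → F} (hf : Differentiable ℝ f) {K : ℝ≥0}
    {s : Set E} (hs : Convex ℝ s) (hK : LipschitzOnWith K (fderiv ℝ f) s) {x z : E}
    (hadd : x + z ∈ s) (hsub : x - z ∈ s) :
    ‖f (x + z) + f (x - z) - (2 : ℝ) • f x‖ ≤ 2 * K * ‖z‖ ^ 2 := by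
  have hline : ∀ (v : E) (τ : ℝ), HasDerivAt (fun τ : ℝ => f (x + τ • v))
      (fderiv ℝ f (x + τ • v) v) τ := fun v τ => by
    have := ((hasDerivAt_id τ).smul_const v).const_add x
    rw [one_smul] at this
    exact (hf _).hasFDerivAt.comp_hasDerivAt τ this
  have hderiv : ∀ τ ∈ Icc (0 : ℝ) 1, HasDerivWithinAt
      (fun τ : ℝ => f (x + τ • z) + f (x + τ • -z))
      (fderiv ℝ f (x + τ • z) z - fderiv ℝ f (x + (-τ) • z) z) (Icc 0 1) τ := fun τ _ =>
    (((hline z τ).add (hline (-z) τ)).congr_deriv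
      (by rw [map_neg, smul_neg, neg_smul, sub_eq_add_neg])).hasDerivWithinAt
  have hbound : ∀ τ ∈ Ico (0 : ℝ) 1,
      ‖fderiv ℝ f (x + τ • z) z - fderiv ℝ f (x + (-τ) • z) z‖ ≤ 2 * K * ‖z‖ ^ 2 := by
    intro τ hτ
    have hlip := hK.norm_sub_le
      (add_smul_mem_of_convex hs hadd hsub ⟨by linarith [hτ.1], hτ.2.le⟩)
      (add_smul_mem_of_convex hs hadd hsub (τ := -τ) ⟨by linarith [hτ.2], by linarith [hτ.1]⟩)
    rw [show x + τ • z - (x + (-τ) • z) = (2 * τ) • z by module, norm_smul,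
      Real.norm_of_nonneg (by linarith [hτ.1])] at hlip
    rw [← sub_apply]
    calc _ ≤ ‖fderiv ℝ f (x + τ • z) - fderiv ℝ f (x + (-τ) • z)‖ * ‖z‖ :=
          ContinuousLinearMap.le_opNorm _ _
      _ ≤ (K * (2 * 1 * ‖z‖)) * ‖z‖ := by
          gcongr
          exact hlip.trans (by gcongr; exact hτ.2.le)
      _ = 2 * K * ‖z‖ ^ 2 := by ring
  convert norm_image_sub_le_of_norm_deriv_le_segment_01' hderiv hbound using 2
  simp only [one_smul, zero_smul, add_zero, sub_eq_add_neg, two_smul]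

section Cutoff

variable {E : Type*} [NormedAddCommGroup E] [NormedSpace ℝ E] [HasContDiffBump E]

/-- A smooth cut-off function, equal to `1` on the ball of radius `R` and to `0` outside the ball
of radius `2R`. -/
def cutoff (R : ℝ) (x : E) : ℝ :=
  (⟨1, 2, one_pos, one_lt_two⟩ : ContDiffBump (0 : E)) (R⁻¹ • x)

lemma contDiff_cutoff (R : ℝ) : ContDiff ℝ 2 (cutoff R : E → ℝ) :=
  (ContDiffBump.contDiff _).comp (contDiff_const_smul _)

lemma continuous_cutoff (R : ℝ) : Continuous (cutoff R : E → ℝ) := (contDiff_cutoff R).continuous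

lemma cutoff_nonneg (R : ℝ) (x : E) : 0 ≤ cutoff R x := ContDiffBump.nonneg _

lemma cutoff_le_one (R : ℝ) (x : E) : cutoff R x ≤ 1 := ContDiffBump.le_one _

lemma abs_cutoff_sub_le_one (R : ℝ) (x y : E) : |cutoff R x - cutoff R y| ≤ 1 :=
  abs_sub_le_of_nonneg_of_le (cutoff_nonneg R x) (cutoff_le_one R x) (cutoff_nonneg R y)
    (cutoff_le_one R y)

lemma cutoff_eq_one {R : ℝ} (hR : 0 < R) {x : E} (hx : ‖x‖ ≤ R) : cutoff R x = 1 := by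
  refine ContDiffBump.one_of_mem_closedBall _ ?_
  rw [mem_closedBall_zero_iff, norm_smul, norm_inv, Real.norm_of_nonneg hR.le, inv_mul_le_iff₀ hR]
  exact hx.trans_eq (mul_one R).symm

lemma cutoff_eq_zero {R : ℝ} (hR : 0 < R) {x : E} (hx : 2 * R ≤ ‖x‖) : cutoff R x = 0 := by
  refine ContDiffBump.zero_of_le_dist _ ?_
  rw [dist_zero_right, norm_smul, norm_inv, Real.norm_of_nonneg hR.le, le_inv_mul_iff₀ hR]
  exact (mul_comm R 2).trans_le hx

lemma hasCompactSupport_cutoff [FiniteDimensional ℝ E] {R : ℝ} (hR : 0 < R) :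
    HasCompactSupport (cutoff R : E → ℝ) := by
  refine HasCompactSupport.intro (isCompact_closedBall 0 (2 * R)) fun x hx => ?_
  rw [mem_closedBall_zero_iff, not_le] at hx
  exact cutoff_eq_zero hR hx.le

lemma cutoff_le_cutoff {R R' : ℝ} (hR : 0 < R) (h : 2 * R ≤ R') (x : E) :
    cutoff R x ≤ cutoff R' x := by
  rcases le_total ‖x‖ (2 * R) with hx | hx
  · rw [cutoff_eq_one (by linarith) (hx.trans h)]; exact cutoff_le_one _ _
  · rw [cutoff_eq_zero hR hx]; exact cutoff_nonneg _ _

lemma eventually_cutoff_eq_one (x : E) : ∀ᶠ n : ℕ in atTop, cutoff ((n : ℝ) + 1) x = 1 := by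
  filter_upwards [eventually_ge_atTop ⌈‖x‖⌉₊] with n hn
  exact cutoff_eq_one (by positivity) ((Nat.ceil_le.1 hn).trans (by linarith))

lemma cutoff_eq_cutoff_one (R : ℝ) (x : E) : cutoff R x = cutoff 1 (R⁻¹ • x) := by
  simp only [cutoff, inv_one, one_smul]

variable (E) in
lemma exists_abs_cutoff_add_sub_le [FiniteDimensional ℝ E] :
    ∃ M, 0 ≤ M ∧ ∀ R, 0 < R → ∀ x z : E, |cutoff R (x + z) - cutoff R x| ≤ M * ‖z‖ / R := by
  obtain ⟨K, hK⟩ := (contDiff_cutoff (E := E) 1).lipschitzWith_of_hasCompactSupport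
    (hasCompactSupport_cutoff one_pos) two_ne_zero
  refine ⟨K, K.2, fun R hR x z => ?_⟩
  calc |cutoff R (x + z) - cutoff R x| = ‖cutoff 1 (R⁻¹ • (x + z)) - cutoff 1 (R⁻¹ • x)‖ := by
        rw [cutoff_eq_cutoff_one, cutoff_eq_cutoff_one R x, Real.norm_eq_abs]
    _ ≤ K * ‖R⁻¹ • (x + z) - R⁻¹ • x‖ := hK.norm_sub_le _ _
    _ = K * ‖z‖ / R := by
        rw [smul_add, add_sub_cancel_left, norm_smul, norm_inv, Real.norm_of_nonneg hR.le]; ring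

variable (E) in
lemma exists_abs_cutoff_second_difference_le [FiniteDimensional ℝ E] :
    ∃ M, 0 ≤ M ∧ ∀ R, 1 ≤ R → ∀ x z : E,
      |cutoff R (x + z) + cutoff R (x - z) - 2 * cutoff R x| ≤ M * ‖z‖ ^ 2 / R := by
  have hsmooth := contDiff_cutoff (E := E) 1
  have hfderiv : ContDiff ℝ 1 (fderiv ℝ (cutoff 1 : E → ℝ)) :=
    hsmooth.fderiv_right one_add_one_eq_two.le
  have hsupp : HasCompactSupport (fderiv ℝ (cutoff 1 : E → ℝ)) :=
    (hasCompactSupport_cutoff one_pos).fderiv ℝ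
  obtain ⟨K, hK⟩ := hfderiv.lipschitzWith_of_hasCompactSupport hsupp one_ne_zero
  refine ⟨2 * K, by positivity, fun R hR x z => ?_⟩
  have hR0 : 0 < R := one_pos.trans_le hR
  have hz : ‖R⁻¹ • z‖ = ‖z‖ / R := by
    rw [norm_smul, norm_inv, Real.norm_of_nonneg hR0.le, inv_mul_eq_div]
  have hsecond := norm_second_difference_le (x := R⁻¹ • x) (z := R⁻¹ • z)
    (hsmooth.differentiable two_ne_zero) convex_univ (hK.lipschitzOnWith (s := univ))
    (mem_univ _) (mem_univ _)
  rw [Real.norm_eq_abs, smul_eq_mul] at hsecond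
  simp only [cutoff_eq_cutoff_one R, smul_add, smul_sub]
  calc |cutoff 1 (R⁻¹ • x + R⁻¹ • z) + cutoff 1 (R⁻¹ • x - R⁻¹ • z) - 2 * cutoff 1 (R⁻¹ • x)|
      ≤ 2 * K * ‖R⁻¹ • z‖ ^ 2 := hsecond
    _ = 2 * K * ‖z‖ ^ 2 / R ^ 2 := by rw [hz, div_pow, mul_div_assoc]
    _ ≤ 2 * K * ‖z‖ ^ 2 / R := by gcongr; exact le_self_pow₀ hR two_ne_zero

end Cutoff

section CutoffError

variable {N : ℕ} {ν β : ℝ}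

/-- The error made far from the diagonal when a truncated operator is applied to the product of a
cut-off function and `ψ_β`. -/
def cutoffError (ν β R : ℝ) (x : Space N) : ℝ :=
  ∫ z, psi β (x + z) * |cutoff R (x + z) - cutoff R x| * kern ν (1 / 2) z

lemma cutoffError_nonneg (ν β R : ℝ) (x : Space N) : 0 ≤ cutoffError ν β R x :=
  integral_nonneg fun _ =>
    mul_nonneg (mul_nonneg (psi_pos _ _).le (abs_nonneg _)) (kern_nonneg _ _ _)

lemma psi_mul_abs_cutoff_sub_le_psi (β R : ℝ) (x z : Space N) :
    psi β (x + z) * |cutoff R (x + z) - cutoff R x| ≤ psi β (x + z) :=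
  mul_le_of_le_one_right (psi_pos β _).le (abs_cutoff_sub_le_one _ _ _)

lemma norm_cutoffError_integrand_le (hβ : 0 ≤ β) (R : ℝ) (x z : Space N) :
    ‖psi β (x + z) * |cutoff R (x + z) - cutoff R x| * kern ν (1 / 2) z‖ ≤ kern ν (1 / 2) z := by
  have hk := kern_nonneg ν (1 / 2) z
  rw [Real.norm_of_nonneg (mul_nonneg (mul_nonneg (psi_pos _ _).le (abs_nonneg _)) hk)]
  exact mul_le_of_le_one_left hk ((psi_mul_abs_cutoff_sub_le_psi _ _ _ _).trans (psi_le_one hβ _))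

lemma measurable_cutoffError_integrand (ν β R : ℝ) :
    Measurable fun p : Space N × Space N =>
      psi β (p.1 + p.2) * |cutoff R (p.1 + p.2) - cutoff R p.1| * kern ν (1 / 2) p.2 := by
  have hψ := (continuous_psi (N := N) β).measurable
  have hcutoff := (continuous_cutoff (E := Space N) R).measurable
  have hkern := measurable_kern (E := Space N) ν (1 / 2)
  fun_prop

lemma integrable_cutoffError_integrand (hν : N < ν) (hβ : 0 ≤ β) (R : ℝ) (x : Space N) :
    Integrable fun z => psi β (x + z) * |cutoff R (x + z) - cutoff R x| * kern ν (1 / 2) z :=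
  (integrable_kern hν one_half_pos).mono'
    ((measurable_cutoffError_integrand ν β R).comp measurable_prodMk_left).aestronglyMeasurable
    (ae_of_all _ (norm_cutoffError_integrand_le hβ R x))

lemma measurable_cutoffError (ν β R : ℝ) : Measurable (cutoffError ν β R : Space N → ℝ) :=
  (measurable_cutoffError_integrand ν β R).stronglyMeasurable.integral_prod_right'.measurable

lemma exists_cutoffError_le (hν : N < ν) (hβ : 0 ≤ β) (hβν : β ≤ ν) :
    ∃ C, ∀ R, ∀ x : Space N, cutoffError ν β R x ≤ C * psi β x := by
  obtain ⟨C, hC, hψ⟩ := exists_psi_mul_rpow_le (N := N) hβ hβν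
  have hkern := integrable_kern (N := N) hν one_half_pos
  have hψν := integrable_psi (N := N) hν
  refine ⟨C * ((∫ z : Space N, kern ν (1 / 2) z) + ∫ z : Space N, psi ν z),
    fun R x => ?_⟩
  have hpt : ∀ z, psi β (x + z) * |cutoff R (x + z) - cutoff R x| * kern ν (1 / 2) z ≤
      C * psi β x * (kern ν (1 / 2) z + psi ν (x + z)) := by
    intro z
    rcases lt_or_ge ‖z‖ (1 / 2) with hz | hz
    · have := psi_pos β x
      have := psi_pos ν (x + z)
      rw [kern_of_lt hz, mul_zero, zero_add]
      positivity
    · rw [kern_of_le hz]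
      refine le_trans ?_ (hψ x z (norm_pos_iff.1 (one_half_pos.trans_le hz)))
      gcongr
      exact psi_mul_abs_cutoff_sub_le_psi _ _ _ _
  calc cutoffError ν β R x ≤ ∫ z, C * psi β x * (kern ν (1 / 2) z + psi ν (x + z)) :=
        integral_mono (integrable_cutoffError_integrand hν hβ R x)
          ((hkern.add (hψν.comp_add_left x)).const_mul (C * psi β x)) hpt
    _ = _ := by
        rw [integral_const_mul, integral_add hkern (hψν.comp_add_left x),
          integral_add_left_eq_self (psi ν) x]
        ring

lemma tendsto_cutoffError (hν : N < ν) (hβ : 0 ≤ β) (x : Space N) :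
    Tendsto (fun n : ℕ => cutoffError ν β ((n : ℝ) + 1) x) atTop (𝓝 0) := by
  rw [← integral_zero (Space N) ℝ]
  refine tendsto_integral_of_dominated_convergence (kern ν (1 / 2))
    (fun n => (integrable_cutoffError_integrand hν hβ _ x).aestronglyMeasurable)
    (integrable_kern hν one_half_pos)
    (fun n => ae_of_all _ (norm_cutoffError_integrand_le hβ _ x)) (ae_of_all _ fun z => ?_)
  refine tendsto_const_nhds.congr' ?_
  filter_upwards [eventually_cutoff_eq_one x, eventually_cutoff_eq_one (x + z)] with n hx hxz
  rw [hx, hxz, sub_self, abs_zero, mul_zero, zero_mul]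

end CutoffError

section TestFunction

variable {N : ℕ} {β : ℝ}

/-- The space-dependent part `cutoff R * ψ_β` of the test function. -/
def testFun (R β : ℝ) (x : Space N) : ℝ := cutoff R x * psi β x

lemma testFun_nonneg (R β : ℝ) (x : Space N) : 0 ≤ testFun R β x :=
  mul_nonneg (cutoff_nonneg R x) (psi_pos β x).le

lemma continuous_testFun (R β : ℝ) : Continuous (testFun R β : Space N → ℝ) :=
  (continuous_cutoff R).mul (continuous_psi β)

lemma hasCompactSupport_testFun {R : ℝ} (hR : 0 < R) (β : ℝ) :
    HasCompactSupport (testFun R β : Space N → ℝ) :=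
  (hasCompactSupport_cutoff hR).mul_right

/-- Up to the product of the first differences of `ψ_β` and of the cut-off, the left-hand side is
`ψ_β x` times a second difference of the cut-off. -/
lemma exists_psi_mul_cutoff_difference_le (hβ : 0 ≤ β) :
    ∃ C, 0 ≤ C ∧ ∀ R, 1 ≤ R → ∀ x z : Space N, ‖z‖ ≤ 1 / 2 →
      psi β (x + z) * (cutoff R (x + z) - cutoff R x) +
        psi β (x - z) * (cutoff R (x - z) - cutoff R x) ≤ C * psi β x / R * ‖z‖ ^ 2 := by
  obtain ⟨C, hC, hψ⟩ := exists_abs_psi_add_sub_le (N := N) hβ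
  obtain ⟨L, hL, hcut⟩ := exists_abs_cutoff_add_sub_le (Space N)
  obtain ⟨M, hM, hcut₂⟩ := exists_abs_cutoff_second_difference_le (Space N)
  refine ⟨M + 2 * (C * L), by positivity, fun R hR x z hz => ?_⟩
  have hψ0 := (psi_pos β x).le
  have hR0 : 0 < R := one_pos.trans_le hR
  have mixed : ∀ w : Space N, ‖w‖ = ‖z‖ →
      (psi β (x + w) - psi β x) * (cutoff R (x + w) - cutoff R x) ≤
        (C * psi β x * ‖z‖) * (L * ‖z‖ / R) := by
    intro w hw
    refine (le_abs_self _).trans ?_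
    rw [abs_mul, ← hw]
    gcongr
    · exact hψ x w (by linarith [one_le_bracket x])
    · exact hcut R hR0 x w
  have hsub := mixed (-z) (norm_neg z)
  rw [← sub_eq_add_neg] at hsub
  calc psi β (x + z) * (cutoff R (x + z) - cutoff R x) +
        psi β (x - z) * (cutoff R (x - z) - cutoff R x)
      = psi β x * (cutoff R (x + z) + cutoff R (x - z) - 2 * cutoff R x) +
          ((psi β (x + z) - psi β x) * (cutoff R (x + z) - cutoff R x) +
            (psi β (x - z) - psi β x) * (cutoff R (x - z) - cutoff R x)) := by ring
    _ ≤ psi β x * (M * ‖z‖ ^ 2 / R) +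
          (C * psi β x * ‖z‖ * (L * ‖z‖ / R) + C * psi β x * ‖z‖ * (L * ‖z‖ / R)) := by
        refine add_le_add (mul_le_mul_of_nonneg_left ?_ hψ0) (add_le_add (mixed z rfl) hsub)
        exact (le_abs_self _).trans (hcut₂ R hR x z)
    _ = (M + 2 * (C * L)) * psi β x / R * ‖z‖ ^ 2 := by field_simp; ring

end TestFunction

section TestInequality

variable {N : ℕ} {α β ν : ℝ}

/-- The second difference quotient of step `h` approximating `Δ`. Like `nonlocal`, it needs no
regularity of `f`, and it is symmetric without boundary terms. -/
def discreteLaplacian (h : ℝ) (f : Space N → ℝ) (x : Space N) : ℝ :=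
  ∑ i, (f (x + h • EuclideanSpace.basisFun (Fin N) ℝ i) +
    f (x - h • EuclideanSpace.basisFun (Fin N) ℝ i) - 2 * f x) / h ^ 2

lemma discreteLaplacian_le {h A : ℝ} (hh : 0 < h) {f : Space N → ℝ} {x : Space N}
    (hf : ∀ z, ‖z‖ = h → f (x + z) + f (x - z) - 2 * f x ≤ A * ‖z‖ ^ 2) :
    discreteLaplacian h f x ≤ N * A := by
  have hterm : ∀ i, (f (x + h • EuclideanSpace.basisFun (Fin N) ℝ i) +
      f (x - h • EuclideanSpace.basisFun (Fin N) ℝ i) - 2 * f x) / h ^ 2 ≤ A := by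
    intro i
    have hz : ‖h • EuclideanSpace.basisFun (Fin N) ℝ i‖ = h := by
      rw [norm_smul, OrthonormalBasis.norm_eq_one, mul_one, Real.norm_of_nonneg hh.le]
    rw [div_le_iff₀ (by positivity)]
    simpa only [hz] using hf _ hz
  calc discreteLaplacian h f x ≤ ∑ _i : Fin N, A := Finset.sum_le_sum fun i _ => hterm i
    _ = N * A := by rw [Finset.sum_const, Finset.card_fin, nsmul_eq_mul]

lemma exists_testFun_second_difference_le (hβ : 0 ≤ β) (hα : α ≤ 2) :
    ∃ C, 0 ≤ C ∧ ∀ R, 1 ≤ R → ∀ x z : Space N, ‖z‖ ≤ 1 / 2 →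
      testFun R β (x + z) + testFun R β (x - z) - 2 * testFun R β x ≤
        C * (bracket x ^ (-α) * testFun R β x + psi β x / R) * ‖z‖ ^ 2 := by
  obtain ⟨C, hC, hψ⟩ := exists_psi_second_difference_le (N := N) hβ
  obtain ⟨M, hM, hmixed⟩ := exists_psi_mul_cutoff_difference_le (N := N) hβ
  refine ⟨C + M, by positivity, fun R hR x z hz => ?_⟩
  have : 0 < R := one_pos.trans_le hR
  have hψ0 := (psi_pos β x).le
  have ht0 := testFun_nonneg R β x
  have hx := (bracket_pos x).le
  have hsmooth : cutoff R x * (psi β (x + z) + psi β (x - z) - 2 * psi β x) ≤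
      C * (bracket x ^ (-α) * testFun R β x) * ‖z‖ ^ 2 :=
    calc cutoff R x * (psi β (x + z) + psi β (x - z) - 2 * psi β x)
        ≤ cutoff R x * (C * psi β x * bracket x ^ (-2 : ℝ) * ‖z‖ ^ 2) :=
          mul_le_mul_of_nonneg_left (hψ x z (by linarith [one_le_bracket x])) (cutoff_nonneg R x)
      _ ≤ cutoff R x * (C * psi β x * bracket x ^ (-α) * ‖z‖ ^ 2) := by
          have := cutoff_nonneg R x
          gcongr
          exact one_le_bracket x
      _ = C * (bracket x ^ (-α) * testFun R β x) * ‖z‖ ^ 2 := by rw [testFun]; ring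
  calc testFun R β (x + z) + testFun R β (x - z) - 2 * testFun R β x
      = cutoff R x * (psi β (x + z) + psi β (x - z) - 2 * psi β x) +
          (psi β (x + z) * (cutoff R (x + z) - cutoff R x) +
            psi β (x - z) * (cutoff R (x - z) - cutoff R x)) := by simp only [testFun]; ring
    _ ≤ C * (bracket x ^ (-α) * testFun R β x) * ‖z‖ ^ 2 + M * psi β x / R * ‖z‖ ^ 2 :=
        add_le_add hsmooth (hmixed R hR x z hz)
    _ = (C * (bracket x ^ (-α) * testFun R β x) + M * (psi β x / R)) * ‖z‖ ^ 2 := by ring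
    _ ≤ ((C + M) * (bracket x ^ (-α) * testFun R β x) + (C + M) * (psi β x / R)) * ‖z‖ ^ 2 := by
        gcongr <;> linarith
    _ = _ := by ring

lemma exists_discreteLaplacian_testFun_le (hβ : 0 ≤ β) (hα : α ≤ 2) :
    ∃ C, 0 ≤ C ∧ ∀ R, 1 ≤ R → ∀ h, 0 < h → h ≤ 1 / 2 → ∀ x : Space N,
      discreteLaplacian h (testFun R β) x ≤
        C * (bracket x ^ (-α) * testFun R β x + psi β x / R) := by
  obtain ⟨C, hC, hdiff⟩ := exists_testFun_second_difference_le (N := N) hβ hα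
  refine ⟨N * C, by positivity, fun R hR h hh hh' x => ?_⟩
  rw [mul_assoc]
  exact discreteLaplacian_le hh fun z hz => hdiff R hR x z (hz.trans_le hh')

lemma integrable_psi_mul_cutoff_sub_mul_kern {ε : ℝ} (hν : N < ν) (hβ : 0 ≤ β) (hε : 0 < ε)
    (R : ℝ) (x : Space N) :
    Integrable fun z => psi β (x + z) * (cutoff R (x + z) - cutoff R x) * kern ν ε z := by
  have hcont : Continuous fun y : Space N => psi β y * (cutoff R y - cutoff R x) :=
    (continuous_psi β).mul ((continuous_cutoff R).sub continuous_const)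
  have hbound : ∀ y, |psi β y * (cutoff R y - cutoff R x)| ≤ 1 := fun y => by
    rw [abs_mul, abs_of_pos (psi_pos β y)]
    exact mul_le_one₀ (psi_le_one hβ y) (abs_nonneg _) (abs_cutoff_sub_le_one R y x)
  simpa only [sub_self, mul_zero, sub_zero] using
    integrable_sub_mul_kern_of_bounded hν hε hcont hbound x

lemma neg_nonlocal_testFun {ε : ℝ} (hν : N < ν) (hβ : 0 ≤ β) (hε : 0 < ε) (R : ℝ) (x : Space N) :
    -nonlocal ν ε (testFun R β) x = cutoff R x * -nonlocal ν ε (psi β) x +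
      ∫ z, psi β (x + z) * (cutoff R (x + z) - cutoff R x) * kern ν ε z := by
  rw [neg_nonlocal, neg_nonlocal, ← integral_const_mul,
    ← integral_add ((integrable_psi_sub_mul_kern hν hβ hε x).const_mul _)
      (integrable_psi_mul_cutoff_sub_mul_kern hν hβ hε R x)]
  refine integral_congr_ae (ae_of_all _ fun z => ?_)
  simp only [testFun]
  ring

lemma setIntegral_psi_mul_cutoff_sub_far_le {ε : ℝ} (hν : N < ν) (hβ : 0 ≤ β) (hε : 0 < ε)
    (hε' : ε ≤ 1 / 2) (R : ℝ) (x : Space N) :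
    ∫ z in (ball 0 (1 / 2))ᶜ, psi β (x + z) * (cutoff R (x + z) - cutoff R x) * kern ν ε z ≤
      cutoffError ν β R x := by
  have herror := integrable_cutoffError_integrand hν hβ R x
  refine (setIntegral_mono_on (integrable_psi_mul_cutoff_sub_mul_kern hν hβ hε R x).integrableOn
    herror.integrableOn measurableSet_ball.compl fun z hz => ?_).trans
    (setIntegral_le_integral herror (ae_of_all _ fun z =>
      mul_nonneg (mul_nonneg (psi_pos _ _).le (abs_nonneg _)) (kern_nonneg _ _ _)))
  rw [mem_compl_iff, mem_ball_zero_iff, not_lt] at hz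
  rw [kern_of_le (hε'.trans hz), kern_of_le hz]
  have := (psi_pos β (x + z)).le
  gcongr
  exact le_abs_self _

lemma exists_neg_nonlocal_testFun_le (hN : 1 ≤ N) {K : ℝ} (hν : N < ν) (hν' : ν < N + 2)
    (hβ : 0 ≤ β)
    (hK : ∀ ε, 0 < ε → ∀ x : Space N,
      -nonlocal ν ε (psi β) x ≤ K * bracket x ^ (-α) * psi β x) :
    ∃ C, 0 ≤ C ∧ ∀ R, 1 ≤ R → ∀ ε, 0 < ε → ε ≤ 1 / 2 → ∀ x : Space N,
      -nonlocal ν ε (testFun R β) x ≤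
        K * (bracket x ^ (-α) * testFun R β x) + C * (psi β x / R) + cutoffError ν β R x := by
  obtain ⟨M, hM, hmixed⟩ := exists_psi_mul_cutoff_difference_le (N := N) hβ
  set c := ∫ z in ball (0 : Space N) 1, ‖z‖ ^ (2 - ν)
  have : 0 ≤ c := integral_nonneg fun z => by positivity
  refine ⟨M * (1 / 2) ^ (N + 2 - ν) * c, by positivity, fun R hR ε hε hε' x => ?_⟩
  have hψ := psi_pos β x
  have hint := integrable_psi_mul_cutoff_sub_mul_kern hν hβ hε R x
  have hweight : cutoff R x * -nonlocal ν ε (psi β) x ≤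
      K * (bracket x ^ (-α) * testFun R β x) :=
    (mul_le_mul_of_nonneg_left (hK ε hε x) (cutoff_nonneg R x)).trans_eq (by rw [testFun]; ring)
  have hnear : ∫ z in ball 0 (1 / 2),
      psi β (x + z) * (cutoff R (x + z) - cutoff R x) * kern ν ε z ≤
        M * psi β x / R * (1 / 2) ^ (N + 2 - ν) * c := by
    have hball := setIntegral_ball_kern_le hN hν' one_half_pos (A := M * psi β x / R) (ε := ε)
      (by positivity) (f := fun y => psi β y * (cutoff R y - cutoff R x)) (x := x)
    simp only [sub_self, mul_zero, sub_zero] at hball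
    exact hball hint.integrableOn fun z hz => hmixed R hR x z hz.le
  calc -nonlocal ν ε (testFun R β) x
      = cutoff R x * -nonlocal ν ε (psi β) x +
        ((∫ z in ball 0 (1 / 2),
            psi β (x + z) * (cutoff R (x + z) - cutoff R x) * kern ν ε z) +
          ∫ z in (ball 0 (1 / 2))ᶜ,
            psi β (x + z) * (cutoff R (x + z) - cutoff R x) * kern ν ε z) := by
        rw [neg_nonlocal_testFun hν hβ hε, integral_add_compl measurableSet_ball hint]
    _ ≤ K * (bracket x ^ (-α) * testFun R β x) +
        (M * psi β x / R * (1 / 2) ^ (N + 2 - ν) * c + cutoffError ν β R x) :=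
        add_le_add hweight
          (add_le_add hnear (setIntegral_psi_mul_cutoff_sub_far_le hν hβ hε hε' R x))
    _ = _ := by ring

/-- The error committed by cutting off the weight `ψ_β` at radius `R`: the first term comes from
small steps, where the differences of the cut-off are of order `1 / R`. -/
def testError (ν β R : ℝ) (x : Space N) : ℝ := psi β x / R + cutoffError ν β R x

lemma testError_nonneg {R : ℝ} (hR : 0 ≤ R) (x : Space N) : 0 ≤ testError ν β R x :=
  add_nonneg (div_nonneg (psi_pos β x).le hR) (cutoffError_nonneg ν β R x)

lemma measurable_testError (ν β R : ℝ) : Measurable (testError ν β R : Space N → ℝ) :=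
  ((continuous_psi β).measurable.div_const R).add (measurable_cutoffError ν β R)

lemma exists_testError_le (hν : N < ν) (hβ : 0 ≤ β) (hβν : β ≤ ν) :
    ∃ B, ∀ R, 1 ≤ R → ∀ x : Space N, testError ν β R x ≤ B * psi β x := by
  obtain ⟨C, hcut⟩ := exists_cutoffError_le hν hβ hβν
  refine ⟨1 + C, fun R hR x => ?_⟩
  rw [testError, add_mul, one_mul]
  exact add_le_add (div_le_self (psi_pos β x).le hR) (hcut R x)

lemma tendsto_testError (hν : N < ν) (hβ : 0 ≤ β) (x : Space N) :
    Tendsto (fun n : ℕ => testError ν β ((n : ℝ) + 1) x) atTop (𝓝 0) := by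
  have hψ : Tendsto (fun n : ℕ => psi β x / ((n : ℝ) + 1)) atTop (𝓝 0) :=
    tendsto_const_nhds.div_atTop (tendsto_atTop_add_const_right _ _ tendsto_natCast_atTop_atTop)
  simpa only [testError, add_zero] using hψ.add (tendsto_cutoffError hν hβ x)

/-- The discrete analogue of `Δ - (-Δ)^s`: a difference quotient for the Laplacian, and a nonlocal
operator truncated at distance `h`, weighted by the constant `c`. -/
def mixedOperator (c ν h : ℝ) (f : Space N → ℝ) (x : Space N) : ℝ :=
  discreteLaplacian h f x - c * nonlocal ν h f x

lemma exists_mixedOperator_testFun_le (hN : 1 ≤ N) {K c : ℝ} (hν : N < ν) (hν' : ν < N + 2)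
    (hβ : 0 ≤ β) (hα : α ≤ 2) (hc : 0 ≤ c) (hK0 : 0 ≤ K)
    (hK : ∀ ε, 0 < ε → ∀ x : Space N,
      -nonlocal ν ε (psi β) x ≤ K * bracket x ^ (-α) * psi β x) :
    ∃ C, 0 ≤ C ∧ ∀ R, 1 ≤ R → ∀ h, 0 < h → h ≤ 1 / 2 → ∀ x : Space N,
      mixedOperator c ν h (testFun R β) x ≤
        C * (bracket x ^ (-α) * testFun R β x + testError ν β R x) := by
  obtain ⟨C₁, hC₁, hlocal⟩ := exists_discreteLaplacian_testFun_le (N := N) hβ hα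
  obtain ⟨C₂, hC₂, hnonlocal⟩ := exists_neg_nonlocal_testFun_le hN hν hν' hβ hK
  refine ⟨C₁ + c * (K + C₂ + 1), by positivity, fun R hR h hh hh' x => ?_⟩
  have htest : 0 ≤ bracket x ^ (-α) * testFun R β x :=
    mul_nonneg (Real.rpow_nonneg (bracket_pos x).le _) (testFun_nonneg R β x)
  have hψ : 0 ≤ psi β x / R := div_nonneg (psi_pos β x).le (by linarith)
  have hcut := cutoffError_nonneg ν β R x
  have hmax : K * (bracket x ^ (-α) * testFun R β x) + C₂ * (psi β x / R) + cutoffError ν β R x ≤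
      (K + C₂ + 1) * (bracket x ^ (-α) * testFun R β x + testError ν β R x) := by
    rw [testError]
    nlinarith [mul_nonneg hK0 hψ, mul_nonneg hK0 hcut, mul_nonneg hC₂ htest, mul_nonneg hC₂ hcut]
  calc mixedOperator c ν h (testFun R β) x
      = discreteLaplacian h (testFun R β) x + c * -nonlocal ν h (testFun R β) x := by
        rw [mixedOperator]; ring
    _ ≤ C₁ * (bracket x ^ (-α) * testFun R β x + testError ν β R x) +
        c * ((K + C₂ + 1) * (bracket x ^ (-α) * testFun R β x + testError ν β R x)) := by
        gcongr
        · refine (hlocal R hR h hh hh' x).trans ?_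
          gcongr
          exact le_add_of_nonneg_right hcut
        · exact (hnonlocal R hR h hh hh' x).trans hmax
    _ = _ := by ring

end TestInequality

/-! ### Symmetry and convexity of the truncated operators -/

section TailIntegrable

variable {N : ℕ} {ν : ℝ}

/-- Integrability against the weight `(1 + |y|)^(-ν)`, the form of membership in `𝓛^s` (with
`ν = N + 2s`) for which the truncated nonlocal operators converge. -/
def TailIntegrable (ν : ℝ) (g : Space N → ℝ) : Prop :=
  Integrable fun y => g y * (1 + ‖y‖) ^ (-ν)

lemma MemLs.tailIntegrable {s : ℝ} (hs : 0 ≤ s) {g : Space N → ℝ} (hg : MemLs s g) :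
    TailIntegrable (N + 2 * s) g := by
  obtain ⟨hmeas, hfin⟩ := hg
  have hν : 0 ≤ (N : ℝ) + 2 * s := by positivity
  have hw : Measurable fun y : Space N => (1 + ‖y‖) ^ (-((N : ℝ) + 2 * s)) := by fun_prop
  have hv : Measurable fun y : Space N => 1 + ‖y‖ ^ ((N : ℝ) + 2 * s) := by fun_prop
  have hint : Integrable fun y => |g y| / (1 + ‖y‖ ^ ((N : ℝ) + 2 * s)) := by
    refine ⟨(hmeas.norm.aemeasurable.div hv.aemeasurable).aestronglyMeasurable, ?_⟩
    rw [hasFiniteIntegral_iff_ofReal (ae_of_all _ fun y => by positivity)]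
    exact hfin
  refine (hint.const_mul 2).mono' (hmeas.mul hw.aestronglyMeasurable) (ae_of_all _ fun y => ?_)
  have hpow : (1 + ‖y‖ ^ ((N : ℝ) + 2 * s)) / 2 ≤ (1 + ‖y‖) ^ ((N : ℝ) + 2 * s) := by
    linarith [Real.one_le_rpow (le_add_of_nonneg_right (norm_nonneg y)) hν,
      Real.rpow_le_rpow (norm_nonneg y) (le_add_of_nonneg_left zero_le_one) hν]
  calc ‖g y * (1 + ‖y‖) ^ (-((N : ℝ) + 2 * s))‖
      = |g y| * ((1 + ‖y‖) ^ ((N : ℝ) + 2 * s))⁻¹ := by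
        rw [norm_mul, Real.norm_eq_abs, Real.norm_of_nonneg (by positivity),
          Real.rpow_neg (by positivity)]
    _ ≤ |g y| * ((1 + ‖y‖ ^ ((N : ℝ) + 2 * s)) / 2)⁻¹ := by gcongr
    _ = 2 * (|g y| / (1 + ‖y‖ ^ ((N : ℝ) + 2 * s))) := by rw [inv_div]; ring

lemma tailIntegrable_of_integrable_mul_psi {β : ℝ} (hν : 0 ≤ ν) (hβν : β ≤ ν) {g : Space N → ℝ}
    (hg : Integrable fun y => g y * psi β y) : TailIntegrable ν g := by
  have hratio : ∀ y : Space N, (1 + ‖y‖) ^ (-ν) ≤ psi β y := fun y =>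
    calc (1 + ‖y‖) ^ (-ν) ≤ bracket y ^ (-ν) := by
          refine Real.rpow_le_rpow_of_nonpos (bracket_pos y) ?_ (neg_nonpos.2 hν)
          rw [bracket, Real.sqrt_le_left (by positivity)]
          nlinarith [norm_nonneg y]
      _ = psi ν y := (psi_eq_bracket ν y).symm
      _ ≤ psi β y := psi_le_psi_of_exponent_le hβν y
  have hmeas : Measurable fun y : Space N => (1 + ‖y‖) ^ (-ν) / psi β y :=
    Measurable.div (by fun_prop) (continuous_psi β).measurable
  refine (hg.mul_bdd (c := 1) hmeas.aestronglyMeasurable (ae_of_all _ fun y => ?_)).congr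
    (ae_of_all _ fun y => ?_)
  · have := psi_pos β y
    rw [Real.norm_of_nonneg (by positivity), div_le_one this]
    exact hratio y
  · have := (psi_pos β y).ne'
    field_simp

lemma tailIntegrable_of_hasCompactSupport (ν : ℝ) {φ : Space N → ℝ} (hφ : Continuous φ)
    (hc : HasCompactSupport φ) : TailIntegrable ν φ := by
  have : Continuous fun y : Space N => (1 + ‖y‖) ^ (-ν) :=
    (by fun_prop : Continuous fun y : Space N => 1 + ‖y‖).rpow_const
      fun y => Or.inl (by positivity)
  exact (hφ.mul this).integrable_of_hasCompactSupport hc.mul_right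

end TailIntegrable

section Nonlocal

variable {N : ℕ} {ν ε : ℝ} {φ g : Space N → ℝ}

/-- The integral of `g` against the truncated kernel centred at `x`: the part of `nonlocal ν ε g x`
that sees `g` away from `x`. -/
def kernAverage (ν ε : ℝ) (g : Space N → ℝ) (x : Space N) : ℝ := ∫ y, g y * kern ν ε (y - x)

lemma norm_mul_kern_sub_le (hν : 0 ≤ ν) (hε : 0 < ε) (g : Space N → ℝ) {r : ℝ} {x : Space N}
    (hx : ‖x‖ ≤ r) (y : Space N) :
    ‖g y * kern ν ε (y - x)‖ ≤ ((1 + r) / ε + 1) ^ ν * ‖g y * (1 + ‖y‖) ^ (-ν)‖ := by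
  rw [norm_mul, norm_mul, Real.norm_of_nonneg (kern_nonneg ν ε _),
    Real.norm_of_nonneg (by positivity : 0 ≤ (1 + ‖y‖) ^ (-ν))]
  calc ‖g y‖ * kern ν ε (y - x)
      ≤ ‖g y‖ * (((1 + ‖x‖) / ε + 1) ^ ν * (1 + ‖y‖) ^ (-ν)) := by
        gcongr; exact kern_sub_le hν hε x y
    _ ≤ ‖g y‖ * (((1 + r) / ε + 1) ^ ν * (1 + ‖y‖) ^ (-ν)) := by gcongr
    _ = _ := by ring

lemma integrable_mul_kern_sub (hν : 0 ≤ ν) (hε : 0 < ε) (hg : Continuous g)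
    (hgt : TailIntegrable ν g) (x : Space N) : Integrable fun y => g y * kern ν ε (y - x) :=
  (hgt.norm.const_mul _).mono'
    (hg.aestronglyMeasurable.mul
      ((measurable_kern ν ε).comp (measurable_id.sub_const x)).aestronglyMeasurable)
    (ae_of_all _ (norm_mul_kern_sub_le hν hε g le_rfl))

lemma norm_kernAverage_le (hν : 0 ≤ ν) (hε : 0 < ε) (hgt : TailIntegrable ν g) {r : ℝ}
    {x : Space N} (hx : ‖x‖ ≤ r) :
    ‖kernAverage ν ε g x‖ ≤ ((1 + r) / ε + 1) ^ ν * ∫ y, ‖g y * (1 + ‖y‖) ^ (-ν)‖ := by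
  rw [← integral_const_mul]
  exact norm_integral_le_of_norm_le (hgt.norm.const_mul _)
    (ae_of_all _ (norm_mul_kern_sub_le hν hε g hx))

lemma integrable_mul_kern (hν : 0 ≤ ν) (hε : 0 < ε) (hg : Continuous g)
    (hgt : TailIntegrable ν g) (x : Space N) : Integrable fun z => g (x + z) * kern ν ε z := by
  simpa only [add_sub_cancel_left] using
    (integrable_mul_kern_sub hν hε hg hgt x).comp_add_left x

lemma integrable_sub_mul_kern (hν : N < ν) (hε : 0 < ε) (hg : Continuous g)
    (hgt : TailIntegrable ν g) (x : Space N) :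
    Integrable fun z => (g x - g (x + z)) * kern ν ε z := by
  simp only [sub_mul]
  exact ((integrable_kern hν hε).const_mul (g x)).sub
    (integrable_mul_kern ((Nat.cast_nonneg N).trans hν.le) hε hg hgt x)

lemma nonlocal_eq (hν : N < ν) (hε : 0 < ε) (hg : Continuous g) (hgt : TailIntegrable ν g)
    (x : Space N) :
    nonlocal ν ε g x = g x * (∫ z : Space N, kern ν ε z) - kernAverage ν ε g x := by
  have hshift : ∫ z, g (x + z) * kern ν ε z = kernAverage ν ε g x := by
    simpa only [kernAverage, add_sub_cancel_left] using
      integral_add_left_eq_self (μ := volume) (fun y => g y * kern ν ε (y - x)) x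
  simp only [nonlocal, sub_mul]
  rw [integral_sub ((integrable_kern hν hε).const_mul (g x))
    (integrable_mul_kern ((Nat.cast_nonneg N).trans hν.le) hε hg hgt x), integral_const_mul, hshift]

lemma integrable_prod_mul_kern (hν : 0 ≤ ν) (hε : 0 < ε) (hφ : Continuous φ)
    (hc : HasCompactSupport φ) (hg : Continuous g) (hgt : TailIntegrable ν g) :
    Integrable (fun p : Space N × Space N => φ p.1 * (g p.2 * kern ν ε (p.2 - p.1)))
      (volume.prod volume) := by
  obtain ⟨r, _, hr⟩ := hc.isCompact.isBounded.exists_pos_norm_le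
  have hmeas : Measurable fun p : Space N × Space N =>
      φ p.1 * (g p.2 * kern ν ε (p.2 - p.1)) := by
    have := measurable_kern (E := Space N) ν ε
    have := hφ.measurable
    have := hg.measurable
    fun_prop
  refine (((hφ.integrable_of_hasCompactSupport hc).norm.mul_prod hgt.norm).const_mul
    (((1 + r) / ε + 1) ^ ν)).mono' hmeas.aestronglyMeasurable (ae_of_all _ fun p => ?_)
  by_cases hx : φ p.1 = 0
  · simp only [hx, zero_mul, norm_zero, mul_zero, le_refl]
  · rw [norm_mul, mul_left_comm]
    gcongr
    exact norm_mul_kern_sub_le hν hε g (hr _ (subset_tsupport _ hx)) p.2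

lemma integral_mul_kern_sub_swap (φ g : Space N → ℝ) (y : Space N) :
    ∫ x, φ x * (g y * kern ν ε (y - x)) = g y * kernAverage ν ε φ y := by
  rw [kernAverage, ← integral_const_mul]
  refine integral_congr_ae (ae_of_all _ fun x => ?_)
  beta_reduce
  rw [← kern_neg, neg_sub]
  ring

lemma integrable_mul_kernAverage (hν : 0 ≤ ν) (hε : 0 < ε) (hφ : Continuous φ)
    (hc : HasCompactSupport φ) (hg : Continuous g) (hgt : TailIntegrable ν g) :
    Integrable (fun x => φ x * kernAverage ν ε g x) := by
  simpa only [kernAverage, integral_const_mul] using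
    (integrable_prod_mul_kern hν hε hφ hc hg hgt).integral_prod_left

lemma integrable_mul_kernAverage_of_hasCompactSupport (hν : 0 ≤ ν) (hε : 0 < ε)
    (hφ : Continuous φ) (hc : HasCompactSupport φ) (hg : Continuous g)
    (hgt : TailIntegrable ν g) : Integrable (fun x => g x * kernAverage ν ε φ x) := by
  simpa only [integral_mul_kern_sub_swap] using
    (integrable_prod_mul_kern hν hε hφ hc hg hgt).integral_prod_right

lemma integral_mul_kernAverage_comm (hν : 0 ≤ ν) (hε : 0 < ε) (hφ : Continuous φ)
    (hc : HasCompactSupport φ) (hg : Continuous g) (hgt : TailIntegrable ν g) :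
    ∫ x, φ x * kernAverage ν ε g x = ∫ x, g x * kernAverage ν ε φ x := by
  have hswap := integral_integral_swap (f := fun x y => φ x * (g y * kern ν ε (y - x)))
    (integrable_prod_mul_kern hν hε hφ hc hg hgt)
  simp only [integral_const_mul, integral_mul_kern_sub_swap] at hswap
  exact hswap

lemma mul_nonlocal_eq (hν : N < ν) (hε : 0 < ε) (hg : Continuous g) (hgt : TailIntegrable ν g)
    (φ : Space N → ℝ) :
    (fun x => φ x * nonlocal ν ε g x) = fun x =>
      φ x * g x * (∫ z : Space N, kern ν ε z) - φ x * kernAverage ν ε g x := by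
  funext x
  rw [nonlocal_eq hν hε hg hgt]
  ring

lemma integrable_mul_nonlocal (hν : N < ν) (hε : 0 < ε) (hφ : Continuous φ)
    (hc : HasCompactSupport φ) (hg : Continuous g) (hgt : TailIntegrable ν g) :
    Integrable (fun x => φ x * nonlocal ν ε g x) := by
  rw [mul_nonlocal_eq hν hε hg hgt]
  exact (((hφ.mul hg).integrable_of_hasCompactSupport hc.mul_right).mul_const _).sub
    (integrable_mul_kernAverage ((Nat.cast_nonneg N).trans hν.le) hε hφ hc hg hgt)

lemma integrable_mul_nonlocal_of_hasCompactSupport (hν : N < ν) (hε : 0 < ε) (hφ : Continuous φ)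
    (hc : HasCompactSupport φ) (hg : Continuous g) (hgt : TailIntegrable ν g) :
    Integrable (fun x => g x * nonlocal ν ε φ x) := by
  rw [mul_nonlocal_eq hν hε hφ (tailIntegrable_of_hasCompactSupport ν hφ hc)]
  exact (((hg.mul hφ).integrable_of_hasCompactSupport hc.mul_left).mul_const _).sub
    (integrable_mul_kernAverage_of_hasCompactSupport ((Nat.cast_nonneg N).trans hν.le) hε
      hφ hc hg hgt)

lemma integral_mul_nonlocal_comm (hν : N < ν) (hε : 0 < ε) (hφ : Continuous φ)
    (hc : HasCompactSupport φ) (hg : Continuous g) (hgt : TailIntegrable ν g) :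
    ∫ x, φ x * nonlocal ν ε g x = ∫ x, g x * nonlocal ν ε φ x := by
  have hν0 : 0 ≤ ν := (Nat.cast_nonneg N).trans hν.le
  have hφg : Integrable fun x => φ x * g x :=
    (hφ.mul hg).integrable_of_hasCompactSupport hc.mul_right
  rw [mul_nonlocal_eq hν hε hg hgt,
    mul_nonlocal_eq hν hε hφ (tailIntegrable_of_hasCompactSupport ν hφ hc)]
  simp only [mul_comm (g _) (φ _)]
  rw [integral_sub (hφg.mul_const _) (integrable_mul_kernAverage hν0 hε hφ hc hg hgt),
    integral_sub (hφg.mul_const _)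
      (integrable_mul_kernAverage_of_hasCompactSupport hν0 hε hφ hc hg hgt),
    integral_mul_kernAverage_comm hν0 hε hφ hc hg hgt]

end Nonlocal

section DiscreteLaplacian

lemma hasCompactSupport_second_difference {E : Type*} [AddCommGroup E] [TopologicalSpace E]
    [IsTopologicalAddGroup E] {φ : E → ℝ} (hc : HasCompactSupport φ) (z : E) :
    HasCompactSupport fun x => φ (x + z) + φ (x - z) - 2 * φ x := by
  have hsub : HasCompactSupport fun x => -(2 * φ x) := (hc.mul_left (f := fun _ => 2)).neg
  simp only [sub_eq_add_neg]
  exact ((hc.comp_homeomorph (Homeomorph.addRight z)).add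
    (hc.comp_homeomorph (Homeomorph.addRight (-z)))).add hsub

lemma integral_mul_second_difference_comm {E : Type*} [AddCommGroup E] [TopologicalSpace E]
    [IsTopologicalAddGroup E] [MeasurableSpace E] [BorelSpace E] {μ : Measure E}
    [μ.IsAddRightInvariant] [IsFiniteMeasureOnCompacts μ] {φ g : E → ℝ} (hφ : Continuous φ)
    (hc : HasCompactSupport φ) (hg : Continuous g) (z : E) :
    ∫ x, φ x * (g (x + z) + g (x - z) - 2 * g x) ∂μ =
      ∫ x, g x * (φ (x + z) + φ (x - z) - 2 * φ x) ∂μ := by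
  have hleft : Integrable (fun x => φ x * (g (x + z) + g (x - z) - 2 * g x)) μ :=
    (hφ.mul (by fun_prop)).integrable_of_hasCompactSupport hc.mul_right
  have hright : Integrable (fun x => g x * (φ (x + z) + φ (x - z) - 2 * φ x)) μ :=
    (hg.mul (by fun_prop)).integrable_of_hasCompactSupport
      (hasCompactSupport_second_difference hc z).mul_left
  set F : E → ℝ := fun x => φ x * g (x + z) - g x * φ (x + z) with hF
  have hFint : Integrable F μ :=
    (show Continuous F by fun_prop).integrable_of_hasCompactSupport
      ((hc.mul_right (f' := fun x => g (x + z))).sub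
        ((hc.comp_homeomorph (Homeomorph.addRight z)).mul_left (f := g)))
  rw [← sub_eq_zero, ← integral_sub hleft hright]
  calc ∫ x, φ x * (g (x + z) + g (x - z) - 2 * g x) -
        g x * (φ (x + z) + φ (x - z) - 2 * φ x) ∂μ
      = ∫ x, F x - F (x - z) ∂μ := by
        congr 1 with x
        simp only [hF, sub_add_cancel]
        ring
    _ = 0 := by
        rw [integral_sub hFint (hFint.comp_sub_right z), integral_sub_right_eq_self, sub_self]

variable {N : ℕ} (h : ℝ) {φ g : Space N → ℝ}

lemma continuous_discreteLaplacian (hg : Continuous g) : Continuous (discreteLaplacian h g) := by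
  unfold discreteLaplacian
  fun_prop

lemma hasCompactSupport_discreteLaplacian (hc : HasCompactSupport φ) :
    HasCompactSupport (discreteLaplacian h φ) := by
  unfold discreteLaplacian
  simp only [div_eq_mul_inv]
  rw [← Finset.sum_fn]
  exact HasCompactSupport.finset_sum fun i _ =>
    (hasCompactSupport_second_difference hc _).mul_right

lemma integral_mul_discreteLaplacian_comm (hφ : Continuous φ) (hc : HasCompactSupport φ)
    (hg : Continuous g) :
    ∫ x, φ x * discreteLaplacian h g x = ∫ x, g x * discreteLaplacian h φ x := by
  have hleft : ∀ z : Space N,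
      Integrable fun x => φ x * ((g (x + z) + g (x - z) - 2 * g x) / h ^ 2) := fun z =>
    (hφ.mul (by fun_prop)).integrable_of_hasCompactSupport hc.mul_right
  have hright : ∀ z : Space N,
      Integrable fun x => g x * ((φ (x + z) + φ (x - z) - 2 * φ x) / h ^ 2) := fun z => by
    simp only [div_eq_mul_inv]
    exact (hg.mul (by fun_prop)).integrable_of_hasCompactSupport
      (hasCompactSupport_second_difference hc z).mul_right.mul_left
  simp only [discreteLaplacian, Finset.mul_sum]
  rw [integral_finsetSum _ fun i _ => hleft _, integral_finsetSum _ fun i _ => hright _]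
  refine Finset.sum_congr rfl fun i _ => ?_
  simp only [← mul_div_assoc]
  rw [integral_div, integral_div, integral_mul_second_difference_comm hφ hc hg]

end DiscreteLaplacian

section MixedOperator

variable {N : ℕ} {c ν h : ℝ} {φ g : Space N → ℝ}

lemma integrable_mul_discreteLaplacian (h : ℝ) (hφ : Continuous φ) (hc : HasCompactSupport φ)
    (hg : Continuous g) : Integrable fun x => φ x * discreteLaplacian h g x :=
  (hφ.mul (continuous_discreteLaplacian h hg)).integrable_of_hasCompactSupport hc.mul_right

lemma integrable_mul_discreteLaplacian_of_hasCompactSupport (h : ℝ) (hφ : Continuous φ)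
    (hc : HasCompactSupport φ) (hg : Continuous g) :
    Integrable fun x => g x * discreteLaplacian h φ x :=
  (hg.mul (continuous_discreteLaplacian h hφ)).integrable_of_hasCompactSupport
    (hasCompactSupport_discreteLaplacian h hc).mul_left

lemma integrable_mul_mixedOperator (c : ℝ) (hν : N < ν) (hh : 0 < h) (hφ : Continuous φ)
    (hc : HasCompactSupport φ) (hg : Continuous g) (hgt : TailIntegrable ν g) :
    Integrable fun x => φ x * mixedOperator c ν h g x := by
  simp only [mixedOperator, mul_sub, mul_left_comm _ c]
  exact (integrable_mul_discreteLaplacian h hφ hc hg).sub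
    ((integrable_mul_nonlocal hν hh hφ hc hg hgt).const_mul c)

lemma integrable_mul_mixedOperator_of_hasCompactSupport (c : ℝ) (hν : N < ν) (hh : 0 < h)
    (hφ : Continuous φ) (hc : HasCompactSupport φ) (hg : Continuous g)
    (hgt : TailIntegrable ν g) : Integrable fun x => g x * mixedOperator c ν h φ x := by
  simp only [mixedOperator, mul_sub, mul_left_comm _ c]
  exact (integrable_mul_discreteLaplacian_of_hasCompactSupport h hφ hc hg).sub
    ((integrable_mul_nonlocal_of_hasCompactSupport hν hh hφ hc hg hgt).const_mul c)

lemma integral_mul_mixedOperator_comm (c : ℝ) (hν : N < ν) (hh : 0 < h) (hφ : Continuous φ)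
    (hc : HasCompactSupport φ) (hg : Continuous g) (hgt : TailIntegrable ν g) :
    ∫ x, φ x * mixedOperator c ν h g x = ∫ x, g x * mixedOperator c ν h φ x := by
  simp only [mixedOperator, mul_sub, mul_left_comm _ c]
  rw [integral_sub (integrable_mul_discreteLaplacian h hφ hc hg)
      ((integrable_mul_nonlocal hν hh hφ hc hg hgt).const_mul c),
    integral_sub (integrable_mul_discreteLaplacian_of_hasCompactSupport h hφ hc hg)
      ((integrable_mul_nonlocal_of_hasCompactSupport hν hh hφ hc hg hgt).const_mul c),
    integral_const_mul, integral_const_mul, integral_mul_nonlocal_comm hν hh hφ hc hg hgt,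
    integral_mul_discreteLaplacian_comm h hφ hc hg]

variable {G G' : ℝ → ℝ}

lemma nonlocal_comp_le (hG : ∀ a b, G a + G' a * (b - a) ≤ G b) (hν : N < ν) (hh : 0 < h)
    (hGc : Continuous G) (hg : Continuous g) (hgt : TailIntegrable ν g)
    (hGt : TailIntegrable ν (G ∘ g)) (x : Space N) :
    nonlocal ν h (G ∘ g) x ≤ G' (g x) * nonlocal ν h g x := by
  rw [nonlocal, nonlocal, ← integral_const_mul]
  refine integral_mono (integrable_sub_mul_kern hν hh (hGc.comp hg) hGt x)
    ((integrable_sub_mul_kern hν hh hg hgt x).const_mul _) fun z => ?_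
  rw [← mul_assoc]
  refine mul_le_mul_of_nonneg_right ?_ (kern_nonneg ν h z)
  simp only [Function.comp_apply]
  linarith [hG (g x) (g (x + z))]

lemma le_discreteLaplacian_comp (hG : ∀ a b, G a + G' a * (b - a) ≤ G b) (h : ℝ)
    (g : Space N → ℝ) (x : Space N) :
    G' (g x) * discreteLaplacian h g x ≤ discreteLaplacian h (G ∘ g) x := by
  rw [discreteLaplacian, discreteLaplacian, Finset.mul_sum]
  refine Finset.sum_le_sum fun i _ => ?_
  rw [← mul_div_assoc]
  set z := h • EuclideanSpace.basisFun (Fin N) ℝ i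
  gcongr
  simp only [Function.comp_apply]
  linarith [hG (g x) (g (x + z)), hG (g x) (g (x - z))]

lemma le_mixedOperator_comp (hG : ∀ a b, G a + G' a * (b - a) ≤ G b) (hc : 0 ≤ c) (hν : N < ν)
    (hh : 0 < h) (hGc : Continuous G) (hg : Continuous g) (hgt : TailIntegrable ν g)
    (hGt : TailIntegrable ν (G ∘ g)) (x : Space N) :
    G' (g x) * mixedOperator c ν h g x ≤ mixedOperator c ν h (G ∘ g) x := by
  rw [mixedOperator, mixedOperator, mul_sub, mul_left_comm]
  exact sub_le_sub (le_discreteLaplacian_comp hG h g x)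
    (mul_le_mul_of_nonneg_left (nonlocal_comp_le hG hν hh hGc hg hgt hGt x) hc)

end MixedOperator

/-! ### Passing to the limit in the discrete operators -/

section FixedTime

variable {N : ℕ}

lemma setIntegral_eq_nonlocal (s ε : ℝ) (f : Space N → ℝ) (x : Space N) :
    ∫ y in {y : Space N | ε ≤ ‖x - y‖}, (f x - f y) / ‖x - y‖ ^ ((N : ℝ) + 2 * s) =
      nonlocal (N + 2 * s) ε f x := by
  have hmeas : MeasurableSet {y : Space N | ε ≤ ‖x - y‖} :=
    measurableSet_le measurable_const (by fun_prop)
  rw [← integral_indicator hmeas, nonlocal, ← integral_add_left_eq_self _ x]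
  congr 1
  ext z
  simp only [kern, indicator, mem_ofPred_eq, sub_add_cancel_left, norm_neg]
  split_ifs
  · rw [Real.rpow_neg (norm_nonneg z), div_eq_mul_inv]
  · rw [mul_zero]

lemma hasFracLaplacianAt_iff {s L : ℝ} {f : Space N → ℝ} {x : Space N} :
    HasFracLaplacianAt s f x L ↔
      Tendsto (fun ε => fracConst N s * nonlocal (N + 2 * s) ε f x) (𝓝[>] 0) (𝓝 L) := by
  simp only [HasFracLaplacianAt, setIntegral_eq_nonlocal]

lemma fracConst_nonneg {s : ℝ} (hs : s ∈ Ioo (0 : ℝ) 1) : 0 ≤ fracConst N s := by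
  have hs0 := hs.1
  have hden : 0 < Real.Gamma (1 - s) := Real.Gamma_pos_of_pos (sub_pos.2 hs.2)
  have : 0 < Real.Gamma (((N : ℝ) + 2 * s) / 2) := Real.Gamma_pos_of_pos (by positivity)
  have := Real.pi_pos
  unfold fracConst
  positivity

section SecondDifference

variable {E : Type*} [NormedAddCommGroup E] [NormedSpace ℝ E] {f : E → ℝ}

lemma hasDerivAt_add_smul (x e : E) (τ : ℝ) : HasDerivAt (fun τ : ℝ => x + τ • e) e τ := by
  simpa only [one_smul] using ((hasDerivAt_id' τ).smul_const e).const_add x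

lemma hasDerivAt_sub_smul (x e : E) (τ : ℝ) : HasDerivAt (fun τ : ℝ => x - τ • e) (-e) τ := by
  simpa only [one_smul] using ((hasDerivAt_id' τ).smul_const e).const_sub x

lemma hasDerivAt_second_difference (hf : Differentiable ℝ f) (x e : E) (τ : ℝ) :
    HasDerivAt (fun τ : ℝ => f (x + τ • e) + f (x - τ • e) - 2 * f x)
      (fderiv ℝ f (x + τ • e) e - fderiv ℝ f (x - τ • e) e) τ := by
  have hsum := (((hf _).hasFDerivAt.comp_hasDerivAt τ (hasDerivAt_add_smul x e τ)).add
    ((hf _).hasFDerivAt.comp_hasDerivAt τ (hasDerivAt_sub_smul x e τ))).sub_const (2 * f x)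
  exact hsum.congr_deriv (by rw [map_neg, ← sub_eq_add_neg])

lemma hasDerivAt_fderiv_symmetric_difference (hf : Differentiable ℝ (fderiv ℝ f)) (x e : E) :
    HasDerivAt (fun τ : ℝ => fderiv ℝ f (x + τ • e) e - fderiv ℝ f (x - τ • e) e)
      (2 * iteratedFDeriv ℝ 2 f x ![e, e]) 0 := by
  have hdir : ∀ y, HasFDerivAt (fun y => fderiv ℝ f y e)
      ((ContinuousLinearMap.apply ℝ ℝ e).comp (fderiv ℝ (fderiv ℝ f) y)) y := fun y =>
    (ContinuousLinearMap.apply ℝ ℝ e).hasFDerivAt.comp y (hf y).hasFDerivAt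
  refine (((hdir _).comp_hasDerivAt 0 (hasDerivAt_add_smul x e 0)).sub
    ((hdir _).comp_hasDerivAt 0 (hasDerivAt_sub_smul x e 0))).congr_deriv ?_
  rw [iteratedFDeriv_two_apply]
  simp only [zero_smul, add_zero, sub_zero, map_neg, sub_neg_eq_add, two_mul]
  rfl

lemma tendsto_second_difference (hf : ContDiff ℝ 2 f) (x e : E) :
    Tendsto (fun h : ℝ => (f (x + h • e) + f (x - h • e) - 2 * f x) / h ^ 2) (𝓝[>] 0)
      (𝓝 (iteratedFDeriv ℝ 2 f x ![e, e])) := by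
  have hfd : Differentiable ℝ f := hf.differentiable two_ne_zero
  have hfd' : Differentiable ℝ (fderiv ℝ f) :=
    (hf.fderiv_right (m := 1) one_add_one_eq_two.le).differentiable one_ne_zero
  refine HasDerivAt.lhopital_zero_nhdsGT (g' := fun τ => 2 * τ)
    (Eventually.of_forall (hasDerivAt_second_difference hfd x e))
    (Eventually.of_forall fun τ => by simpa using hasDerivAt_pow 2 τ)
    (eventually_nhdsWithin_of_forall fun τ (hτ : 0 < τ) => by positivity) ?_ ?_ ?_
  · have hcont := (hasDerivAt_second_difference hfd x e 0).continuousAt.tendsto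
    simp only [zero_smul, add_zero, sub_zero, ← two_mul, sub_self] at hcont
    simpa only [two_mul] using hcont.mono_left nhdsWithin_le_nhds
  · exact ((continuous_pow 2).tendsto' _ _ (zero_pow two_ne_zero)).mono_left nhdsWithin_le_nhds
  · have hslope :=
      (hasDerivAt_fderiv_symmetric_difference hfd' x e).tendsto_slope_zero_right.div_const 2
    rw [mul_div_cancel_left₀ _ two_ne_zero] at hslope
    refine hslope.congr fun τ => ?_
    simp only [zero_add, zero_smul, add_zero, sub_zero, sub_self, smul_eq_mul]
    field_simp

end SecondDifference

lemma tendsto_discreteLaplacian {f : Space N → ℝ} (hf : ContDiff ℝ 2 f) (x : Space N) :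
    Tendsto (fun h : ℝ => discreteLaplacian h f x) (𝓝[>] 0)
      (𝓝 ((Laplacian.laplacian f : Space N → ℝ) x)) := by
  rw [InnerProductSpace.laplacian_eq_iteratedFDeriv_orthonormalBasis f
    (EuclideanSpace.basisFun (Fin N) ℝ)]
  exact tendsto_finsetSum _ fun i _ => tendsto_second_difference hf x _

lemma exists_second_difference_bound {f : Space N → ℝ} (hf : ContDiff ℝ 2 f) (r : ℝ) :
    ∃ K, 0 ≤ K ∧ ∀ x z : Space N, ‖x‖ ≤ r → ‖z‖ ≤ 1 →
      |f (x + z) + f (x - z) - 2 * f x| ≤ K * ‖z‖ ^ 2 := by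
  have hconv : Convex ℝ (closedBall (0 : Space N) (r + 1)) := convex_closedBall _ _
  obtain ⟨K, hK⟩ := (hf.fderiv_right (m := 1) one_add_one_eq_two.le).contDiffOn
    |>.exists_lipschitzOnWith one_ne_zero hconv (isCompact_closedBall _ _)
  refine ⟨2 * K, by positivity, fun x z hx hz => ?_⟩
  refine norm_second_difference_le (hf.differentiable two_ne_zero) hconv hK ?_ ?_
  · exact mem_closedBall_zero_iff.2 ((norm_add_le _ _).trans (add_le_add hx hz))
  · exact mem_closedBall_zero_iff.2 ((norm_sub_le _ _).trans (add_le_add hx hz))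

lemma discreteLaplacian_neg (h : ℝ) (f : Space N → ℝ) (x : Space N) :
    discreteLaplacian h (-f) x = -discreteLaplacian h f x := by
  simp only [discreteLaplacian, Pi.neg_apply, ← Finset.sum_neg_distrib]
  exact Finset.sum_congr rfl fun i _ => by ring

lemma exists_abs_discreteLaplacian_le {f : Space N → ℝ} (hf : ContDiff ℝ 2 f) (r : ℝ) :
    ∃ B, ∀ x : Space N, ‖x‖ ≤ r → ∀ h, 0 < h → h ≤ 1 → |discreteLaplacian h f x| ≤ B := by
  obtain ⟨K, -, hK⟩ := exists_second_difference_bound hf r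
  refine ⟨N * K, fun x hx h hh hh' => abs_le'.2 ⟨?_, ?_⟩⟩
  · exact discreteLaplacian_le hh fun z hz => (le_abs_self _).trans (hK x z hx (hz.trans_le hh'))
  · rw [← discreteLaplacian_neg]
    refine discreteLaplacian_le hh fun z hz => ?_
    have := (neg_le_abs _).trans (hK x z hx (hz.trans_le hh'))
    simp only [Pi.neg_apply]
    linarith

section Nonlocal

variable {ν : ℝ} {f : Space N → ℝ}

lemma exists_abs_nonlocal_le {ε : ℝ} (hν : N < ν) (hε : 0 < ε) (hf : Continuous f)
    (hft : TailIntegrable ν f) (r : ℝ) :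
    ∃ B, ∀ x : Space N, ‖x‖ ≤ r → |nonlocal ν ε f x| ≤ B := by
  obtain ⟨F, hF⟩ := (isCompact_closedBall (0 : Space N) r).exists_bound_of_continuousOn
    hf.continuousOn
  have hκ : 0 ≤ ∫ z : Space N, kern ν ε z := integral_nonneg (kern_nonneg ν ε)
  refine ⟨F * (∫ z : Space N, kern ν ε z) + ((1 + r) / ε + 1) ^ ν *
    ∫ y, ‖f y * (1 + ‖y‖) ^ (-ν)‖, fun x hx => ?_⟩
  rw [nonlocal_eq hν hε hf hft]
  refine (abs_sub _ _).trans (add_le_add ?_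
    (norm_kernAverage_le ((Nat.cast_nonneg N).trans hν.le) hε hft hx))
  rw [abs_mul, abs_of_nonneg hκ]
  exact mul_le_mul_of_nonneg_right (hF x (mem_closedBall_zero_iff.2 hx)) hκ

lemma integrable_add_sub_mul_kern {ε : ℝ} (hν : N < ν) (hε : 0 < ε) (hf : Continuous f)
    (hft : TailIntegrable ν f) (x : Space N) :
    Integrable fun z => (f (x + z) - f x) * kern ν ε z := by
  simpa only [Pi.neg_def, ← neg_mul, neg_sub] using
    (integrable_sub_mul_kern hν hε hf hft x).neg

lemma neg_nonlocal_eq_setIntegral_ball_add {ε r : ℝ} (hν : N < ν) (hε : 0 < ε) (hεr : ε ≤ r)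
    (hf : Continuous f) (hft : TailIntegrable ν f) (x : Space N) :
    -nonlocal ν ε f x =
      (∫ z in ball (0 : Space N) r, (f (x + z) - f x) * kern ν ε z) + -nonlocal ν r f x := by
  have hint := integrable_add_sub_mul_kern hν hε hf hft x
  have hfar : ∫ z in (ball (0 : Space N) r)ᶜ, (f (x + z) - f x) * kern ν ε z =
      -nonlocal ν r f x := by
    rw [neg_nonlocal, ← integral_indicator measurableSet_ball.compl]
    congr 1
    ext z
    by_cases hz : r ≤ ‖z‖
    · rw [indicator_of_mem (by simpa using hz), kern_of_le (hεr.trans hz), kern_of_le hz]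
    · rw [indicator_of_notMem (by simpa using hz), kern_of_lt (not_le.1 hz), mul_zero]
  rw [neg_nonlocal, ← hfar, integral_add_compl measurableSet_ball hint]

lemma abs_setIntegral_ball_kern_le (hN : 1 ≤ N) {ε r A : ℝ} (hν : ν < N + 2) (hr : 0 < r)
    (hA : 0 ≤ A) {x : Space N}
    (hint : IntegrableOn (fun z => (f (x + z) - f x) * kern ν ε z) (ball 0 r))
    (hf : ∀ z, ‖z‖ < r → |f (x + z) + f (x - z) - 2 * f x| ≤ A * ‖z‖ ^ 2) :
    |∫ z in ball 0 r, (f (x + z) - f x) * kern ν ε z| ≤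
      A * r ^ (N + 2 - ν) * ∫ z in ball (0 : Space N) 1, ‖z‖ ^ (2 - ν) := by
  have hneg : (fun z => ((-f) (x + z) - (-f) x) * kern ν ε z) =
      fun z => -((f (x + z) - f x) * kern ν ε z) := by
    ext z
    simp only [Pi.neg_apply]
    ring
  refine abs_le'.2 ⟨setIntegral_ball_kern_le hN hν hr hA hint
    fun z hz => (le_abs_self _).trans (hf z hz), ?_⟩
  rw [← integral_neg, ← hneg]
  refine setIntegral_ball_kern_le hN hν hr hA (hneg ▸ hint.neg) fun z hz => ?_
  have := (neg_le_abs _).trans (hf z hz)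
  simp only [Pi.neg_apply]
  linarith

lemma exists_abs_nonlocal_le_uniform (hN : 1 ≤ N) (hν : N < ν) (hν' : ν < N + 2)
    (hf : ContDiff ℝ 2 f) (hft : TailIntegrable ν f) (r : ℝ) :
    ∃ B, ∀ x : Space N, ‖x‖ ≤ r → ∀ h, 0 < h → h ≤ 1 → |nonlocal ν h f x| ≤ B := by
  obtain ⟨K, hK0, hK⟩ := exists_second_difference_bound hf r
  obtain ⟨B, hB⟩ := exists_abs_nonlocal_le hν one_pos hf.continuous hft r
  refine ⟨K * 1 ^ (N + 2 - ν) * (∫ z in ball (0 : Space N) 1, ‖z‖ ^ (2 - ν)) + B,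
    fun x hx h hh hh' => ?_⟩
  rw [← abs_neg, neg_nonlocal_eq_setIntegral_ball_add hν hh hh' hf.continuous hft]
  refine (abs_add_le _ _).trans (add_le_add ?_ ((abs_neg _).trans_le (hB x hx)))
  exact abs_setIntegral_ball_kern_le hN hν' one_pos hK0
    (integrable_add_sub_mul_kern hν hh hf.continuous hft x).integrableOn
    fun z hz => hK x z hx hz.le

lemma exists_abs_mixedOperator_le (hN : 1 ≤ N) {c : ℝ} (hν : N < ν) (hν' : ν < N + 2)
    (hf : ContDiff ℝ 2 f) (hft : TailIntegrable ν f) (r : ℝ) :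
    ∃ B, ∀ x : Space N, ‖x‖ ≤ r → ∀ h, 0 < h → h ≤ 1 → |mixedOperator c ν h f x| ≤ B := by
  obtain ⟨B₁, hB₁⟩ := exists_abs_discreteLaplacian_le hf r
  obtain ⟨B₂, hB₂⟩ := exists_abs_nonlocal_le_uniform hN hν hν' hf hft r
  refine ⟨B₁ + |c| * B₂, fun x hx h hh hh' => (abs_sub _ _).trans ?_⟩
  rw [abs_mul]
  have hlocal := hB₁ x hx h hh hh'
  have hnonlocal := hB₂ x hx h hh hh'
  gcongr

end Nonlocal

section Test

variable {ν c h : ℝ} {f φ : Space N → ℝ}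

lemma integral_comp_test_mixedOperator_le {G G' : ℝ → ℝ}
    (hG : ∀ a b, G a + G' a * (b - a) ≤ G b) (hc : 0 ≤ c) (hν : N < ν) (hh : 0 < h)
    (hGc : Continuous G) (hGc' : Continuous G') (hf : Continuous f)
    (hft : TailIntegrable ν f) (hGt : TailIntegrable ν (G ∘ f)) (hφ : Continuous φ)
    (hφc : HasCompactSupport φ) (hφ0 : ∀ x, 0 ≤ φ x) :
    ∫ x, φ x * G' (f x) * mixedOperator c ν h f x ≤ ∫ x, G (f x) * mixedOperator c ν h φ x := by
  have hcomp := integral_mul_mixedOperator_comm c hν hh hφ hφc (hGc.comp hf) hGt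
  refine le_of_le_of_eq ?_ hcomp
  refine integral_mono (integrable_mul_mixedOperator c hν hh (hφ.mul (hGc'.comp hf))
    hφc.mul_right hf hft) (integrable_mul_mixedOperator c hν hh hφ hφc (hGc.comp hf) hGt)
    fun x => ?_
  simp only [mul_assoc]
  exact mul_le_mul_of_nonneg_left (le_mixedOperator_comp hG hc hν hh hGc hf hft hGt x) (hφ0 x)

lemma tendsto_integral_mul_mixedOperator (hN : 1 ≤ N) (hν : N < ν) (hν' : ν < N + 2)
    {D : Space N → ℝ} (hf : ContDiff ℝ 2 f) (hft : TailIntegrable ν f)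
    (hD : ∀ x, Tendsto (fun h => mixedOperator c ν h f x) (𝓝[>] 0) (𝓝 (D x)))
    (hφ : Continuous φ) (hφc : HasCompactSupport φ) :
    Tendsto (fun h => ∫ x, φ x * mixedOperator c ν h f x) (𝓝[>] 0) (𝓝 (∫ x, φ x * D x)) := by
  obtain ⟨r, -, hr⟩ := hφc.isCompact.isBounded.exists_pos_norm_le
  obtain ⟨B, hB⟩ := exists_abs_mixedOperator_le (c := c) hN hν hν' hf hft r
  have hsmall : ∀ᶠ h : ℝ in 𝓝[>] 0, 0 < h ∧ h ≤ 1 := Ioc_mem_nhdsGT one_pos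
  refine tendsto_integral_filter_of_dominated_convergence (fun x => ‖φ x‖ * B) ?_ ?_
    ((hφ.integrable_of_hasCompactSupport hφc).norm.mul_const B)
    (ae_of_all _ fun x => (hD x).const_mul (φ x))
  · filter_upwards [hsmall] with h hh
    exact (integrable_mul_mixedOperator c hν hh.1 hφ hφc hf.continuous hft).aestronglyMeasurable
  · filter_upwards [hsmall] with h hh
    refine ae_of_all _ fun x => ?_
    rw [norm_mul]
    rcases eq_or_ne (φ x) 0 with hx | hx
    · simp only [hx, norm_zero, zero_mul, le_refl]
    · exact mul_le_mul_of_nonneg_left (hB x (hr x (subset_tsupport _ hx)) h hh.1 hh.2)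
        (norm_nonneg _)

lemma integral_comp_test_le (hN : 1 ≤ N) (hν : N < ν) (hν' : ν < N + 2) (hc : 0 ≤ c)
    {G G' : ℝ → ℝ} (hG : ∀ a b, G a + G' a * (b - a) ≤ G b) (hG0 : ∀ a, 0 ≤ G a)
    (hGc : Continuous G) (hGc' : Continuous G') {D Φ : Space N → ℝ} (hf : ContDiff ℝ 2 f)
    (hft : TailIntegrable ν f) (hGt : TailIntegrable ν (G ∘ f))
    (hD : ∀ x, Tendsto (fun h => mixedOperator c ν h f x) (𝓝[>] 0) (𝓝 (D x)))
    (hφ : Continuous φ) (hφc : HasCompactSupport φ) (hφ0 : ∀ x, 0 ≤ φ x)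
    (hΦ : ∀ h, 0 < h → h ≤ 1 / 2 → ∀ x, mixedOperator c ν h φ x ≤ Φ x)
    (hΦi : Integrable fun x => G (f x) * Φ x) :
    ∫ x, φ x * G' (f x) * D x ≤ ∫ x, G (f x) * Φ x := by
  refine le_of_tendsto (tendsto_integral_mul_mixedOperator hN hν hν' hf hft hD
    (hφ.mul (hGc'.comp hf.continuous)) hφc.mul_right) ?_
  filter_upwards [Ioc_mem_nhdsGT one_half_pos] with h hh
  refine (integral_comp_test_mixedOperator_le hG hc hν hh.1 hGc hGc' hf.continuous hft hGt
    hφ hφc hφ0).trans (integral_mono ?_ hΦi fun x => ?_)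
  · exact integrable_mul_mixedOperator_of_hasCompactSupport c hν hh.1 hφ hφc
      (hGc.comp hf.continuous) hGt
  · exact mul_le_mul_of_nonneg_left (hΦ h hh.1 hh.2 x) (hG0 (f x))

end Test

end FixedTime

/-! ### The convex profile -/

lemma bracket_eq_norm_toLp {E : Type*} [NormedAddCommGroup E] (x : E) :
    bracket x = ‖WithLp.toLp 2 ((1 : ℝ), x)‖ := by
  simp [WithLp.prod_norm_eq_of_L2, bracket]

lemma convexOn_bracket {E : Type*} [NormedAddCommGroup E] [NormedSpace ℝ E] :
    ConvexOn ℝ univ (bracket : E → ℝ) := by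
  refine ⟨convex_univ, fun x _ y _ a b ha hb hab => ?_⟩
  have hsplit : WithLp.toLp 2 ((1 : ℝ), a • x + b • y) =
      a • WithLp.toLp 2 ((1 : ℝ), x) + b • WithLp.toLp 2 ((1 : ℝ), y) := by
    rw [← WithLp.toLp_smul, ← WithLp.toLp_smul, ← WithLp.toLp_add, Prod.smul_mk, Prod.smul_mk,
      Prod.mk_add_mk, smul_eq_mul, smul_eq_mul, mul_one, mul_one, hab]
  simp only [bracket_eq_norm_toLp, hsplit, smul_eq_mul]
  refine (norm_add_le _ _).trans_eq ?_
  rw [norm_smul_of_nonneg ha, norm_smul_of_nonneg hb]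

lemma tangent_le_of_convexOn_univ {f : ℝ → ℝ} (hf : ConvexOn ℝ univ f) {a : ℝ}
    (hd : DifferentiableAt ℝ f a) (b : ℝ) : f a + deriv f a * (b - a) ≤ f b := by
  rcases lt_trichotomy a b with hab | rfl | hab
  · have hslope := hf.deriv_le_slope (mem_univ a) (mem_univ b) hab hd
    rw [slope_def_field, le_div_iff₀ (sub_pos.2 hab)] at hslope
    linarith
  · rw [sub_self, mul_zero, add_zero]
  · have hslope := hf.slope_le_deriv (mem_univ b) (mem_univ a) hab hd
    rw [slope_def_field, div_le_iff₀ (sub_pos.2 hab)] at hslope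
    linarith

/-- A convex `C¹` substitute for `|r| ^ p`, bounded by it and vanishing only at `0`; the bracket
removes the singularity of `|r|`, so that `p = 1` is allowed. -/
def profile (p r : ℝ) : ℝ := (bracket r - 1) ^ p

section Profile

variable {p : ℝ}

lemma profile_nonneg (p r : ℝ) : 0 ≤ profile p r :=
  Real.rpow_nonneg (sub_nonneg.2 (one_le_bracket r)) p

lemma profile_zero (hp : p ≠ 0) : profile p 0 = 0 := by
  simp [profile, bracket, Real.zero_rpow hp]

lemma eq_zero_of_profile_eq_zero (hp : p ≠ 0) {r : ℝ} (h : profile p r = 0) : r = 0 := by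
  have hbracket : bracket r = 1 :=
    sub_eq_zero.1 ((Real.rpow_eq_zero (sub_nonneg.2 (one_le_bracket r)) hp).1 h)
  have hsq := bracket_sq r
  rw [hbracket, one_pow, left_eq_add] at hsq
  exact norm_eq_zero.1 (eq_zero_of_pow_eq_zero hsq)

lemma contDiff_profile (hp : 1 ≤ p) : ContDiff ℝ 1 (profile p) := by
  have hbracket : ContDiff ℝ 1 (bracket : ℝ → ℝ) :=
    (contDiff_const.add (contDiff_norm_sq ℝ)).sqrt fun r => by positivity
  exact_mod_cast (hbracket.sub contDiff_const).rpow_const_of_le (m := 1) (by exact_mod_cast hp)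

lemma convexOn_profile (hp : 1 ≤ p) : ConvexOn ℝ univ (profile p) := by
  refine ⟨convex_univ, fun x _ y _ a b ha hb hab => ?_⟩
  have hx := sub_nonneg.2 (one_le_bracket x)
  have hy := sub_nonneg.2 (one_le_bracket y)
  have hbracket := convexOn_bracket.2 (mem_univ x) (mem_univ y) ha hb hab
  calc profile p (a • x + b • y) ≤ (a • (bracket x - 1) + b • (bracket y - 1)) ^ p := by
        refine Real.rpow_le_rpow (sub_nonneg.2 (one_le_bracket _)) ?_ (by linarith)
        simp only [smul_eq_mul] at hbracket ⊢
        linarith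
    _ ≤ a • profile p x + b • profile p y := (convexOn_rpow hp).2 hx hy ha hb hab

lemma profile_le_abs_rpow (hp : 0 ≤ p) (r : ℝ) : profile p r ≤ |r| ^ p := by
  refine Real.rpow_le_rpow (sub_nonneg.2 (one_le_bracket r)) ?_ hp
  have hle := bracket_add_le 0 r
  have hzero : bracket (0 : ℝ) = 1 := by simp [bracket]
  rw [zero_add, hzero, Real.norm_eq_abs] at hle
  linarith

end Profile

/-! ### Integration in time -/

section Strip

variable {N : ℕ} {T t : ℝ} {u : Space N → ℝ → ℝ}

/-- The time derivative of `u`, defined through the derivative within `ℝ^N × [0,T]` so that it is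
continuous up to `t = 0` and `t = T`. -/
def timeDeriv (T : ℝ) (u : Space N → ℝ → ℝ) (z : Space N × ℝ) : ℝ :=
  fderivWithin ℝ (fun z : Space N × ℝ => u z.1 z.2) (univ ×ˢ Icc 0 T) z (0, 1)

section Regularity

variable (hu : ContDiffOn ℝ 2 (fun z : Space N × ℝ => u z.1 z.2) (univ ×ˢ Icc 0 T))

include hu

lemma continuousOn_timeDeriv (hT : 0 < T) : ContinuousOn (timeDeriv T u) (univ ×ˢ Icc 0 T) :=
  (hu.continuousOn_fderivWithin (uniqueDiffOn_univ.prod (uniqueDiffOn_Icc hT))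
    one_le_two).clm_apply continuousOn_const

lemma continuous_timeDeriv_slice (hT : 0 < T) (ht : t ∈ Icc 0 T) :
    Continuous fun x => timeDeriv T u (x, t) :=
  (continuousOn_timeDeriv hu hT).comp_continuous (Continuous.prodMk_left t)
    fun x => ⟨mem_univ x, ht⟩

lemma hasDerivWithinAt_timeDeriv (x : Space N) (ht : t ∈ Icc 0 T) :
    HasDerivWithinAt (u x) (timeDeriv T u (x, t)) (Icc 0 T) t := by
  have hline : HasDerivWithinAt (fun τ : ℝ => (x, τ)) ((0 : Space N), (1 : ℝ)) (Icc 0 T) t :=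
    (hasDerivWithinAt_const t _ x).prodMk (hasDerivWithinAt_id t _)
  exact (hu.differentiableOn two_ne_zero (x, t) ⟨mem_univ x, ht⟩).hasFDerivWithinAt
    |>.comp_hasDerivWithinAt t hline fun τ hτ => ⟨mem_univ x, hτ⟩

lemma derivWithin_eq_timeDeriv (x : Space N) (ht : t ∈ Ioc 0 T) :
    derivWithin (fun τ => u x τ) (Ioc 0 T) t = timeDeriv T u (x, t) :=
  ((hasDerivWithinAt_timeDeriv hu x (Ioc_subset_Icc_self ht)).mono
    Ioc_subset_Icc_self).derivWithin (uniqueDiffOn_Ioc 0 T t ht)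

lemma contDiff_slice (ht : t ∈ Icc 0 T) : ContDiff ℝ 2 fun x => u x t :=
  contDiffOn_univ.1 <| hu.comp (contDiff_id.prodMk contDiff_const).contDiffOn
    fun x _ => ⟨mem_univ x, ht⟩

lemma IsSolutionEquation.tendsto_mixedOperator {s : ℝ} {ρ : Space N → ℝ}
    (heq : IsSolutionEquation s T ρ u) (ht : t ∈ Ioc 0 T) (x : Space N) :
    Tendsto (fun h => mixedOperator (fracConst N s) (N + 2 * s) h (fun y => u y t) x) (𝓝[>] 0)
      (𝓝 (ρ x * timeDeriv T u (x, t))) := by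
  obtain ⟨L, hL, hequation⟩ := heq.equation x t ht
  rw [derivWithin_eq_timeDeriv hu x ht] at hequation
  rw [show ρ x * timeDeriv T u (x, t) =
    (Laplacian.laplacian (fun y : Space N => u y t) : Space N → ℝ) x - L by linarith]
  exact (tendsto_discreteLaplacian (contDiff_slice hu (Ioc_subset_Icc_self ht)) x).sub
    (hasFracLaplacianAt_iff.1 hL)

end Regularity

lemma volume_restrict_strip (I : Set ℝ) :
    (volume : Measure (Space N × ℝ)).restrict (univ ×ˢ I) =
      (volume : Measure (Space N)).prod (volume.restrict I) := by
  rw [Measure.volume_eq_prod, ← Measure.prod_restrict, Measure.restrict_univ]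

section Duhamel

variable {w : Space N → ℝ} {q : Space N → ℝ → ℝ} (hw : Continuous w)
  (hwc : HasCompactSupport w)
  (hq : ContinuousOn (fun z : Space N × ℝ => q z.1 z.2) (univ ×ˢ Icc 0 t))

include hw hwc hq

lemma integrable_mul_strip : Integrable (fun z : Space N × ℝ => w z.1 * q z.1 z.2)
    ((volume : Measure (Space N)).prod (volume.restrict (Ioc 0 t))) := by
  have hcont : ContinuousOn (fun z : Space N × ℝ => w z.1 * q z.1 z.2) (univ ×ˢ Icc 0 t) :=
    (hw.comp continuous_fst).continuousOn.mul hq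
  have hsupp : IntegrableOn (fun z : Space N × ℝ => w z.1 * q z.1 z.2)
      (tsupport w ×ˢ Icc 0 t) :=
    (hcont.mono (prod_mono (subset_univ _) Subset.rfl)).integrableOn_compact
      (hwc.isCompact.prod isCompact_Icc)
  rw [← volume_restrict_strip]
  refine IntegrableOn.of_forall_sdiff_eq_zero hsupp
    (MeasurableSet.univ.prod measurableSet_Ioc) ?_
  rintro ⟨x, τ⟩ ⟨⟨-, hτ⟩, hx⟩
  have hx' : x ∉ tsupport w := fun hx' => hx ⟨hx', Ioc_subset_Icc_self hτ⟩
  exact mul_eq_zero_of_left (image_eq_zero_of_notMem_tsupport hx') _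

lemma integral_mul_eq_integral_integral (ht : 0 ≤ t) {v : Space N → ℝ → ℝ}
    (hvc : ∀ x, ContinuousOn (v x) (Icc 0 t))
    (hv : ∀ x, ∀ τ ∈ Ioo 0 t, HasDerivAt (v x) (q x τ) τ) (hv0 : ∀ x, v x 0 = 0) :
    ∫ x, w x * v x t = ∫ τ in Ioc 0 t, ∫ x, w x * q x τ := by
  have hftc : ∀ x, ∫ τ in Ioc 0 t, q x τ = v x t := by
    intro x
    have hqx : ContinuousOn (q x) (Icc 0 t) :=
      hq.comp (f := fun τ : ℝ => (x, τ)) (by fun_prop) fun τ hτ => ⟨mem_univ x, hτ⟩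
    rw [← intervalIntegral.integral_of_le ht,
      intervalIntegral.integral_eq_sub_of_hasDerivAt_of_le ht (hvc x) (hv x)
        (hqx.intervalIntegrable_of_Icc ht), hv0, sub_zero]
  rw [← integral_integral_swap (integrable_mul_strip hw hwc hq)]
  simp only [integral_const_mul, hftc]

end Duhamel

/-- The time derivative of `exp (-lam τ) * G(u(x, τ))`, which the Gronwall argument integrates. -/
def discountedRate (lam : ℝ) (G : ℝ → ℝ) (T : ℝ) (u : Space N → ℝ → ℝ) (x : Space N) (τ : ℝ) : ℝ :=
  Real.exp (-lam * τ) * (deriv G (u x τ) * timeDeriv T u (x, τ) - lam * G (u x τ))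

section DiscountedRate

variable {G : ℝ → ℝ} (hu : ContDiffOn ℝ 2 (fun z : Space N × ℝ => u z.1 z.2) (univ ×ˢ Icc 0 T))
  (hG : ContDiff ℝ 1 G) (ht : t ∈ Ioc 0 T)

include hu hG ht

lemma continuousOn_discountedRate (lam : ℝ) :
    ContinuousOn (fun z : Space N × ℝ => discountedRate lam G T u z.1 z.2)
      (univ ×ˢ Icc 0 t) := by
  refine ContinuousOn.mono ?_ (prod_mono Subset.rfl (Icc_subset_Icc_right ht.2))
  have hrate := ((hG.continuous_deriv le_rfl).comp_continuousOn hu.continuousOn).mul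
    (continuousOn_timeDeriv hu (ht.1.trans_le ht.2))
  have hvalue := hG.continuous.comp_continuousOn hu.continuousOn
  exact ContinuousOn.mul (by fun_prop) (hrate.sub (continuousOn_const.mul hvalue))

lemma hasDerivAt_exp_mul_comp (lam : ℝ) (x : Space N) {τ : ℝ} (hτ : τ ∈ Ioo 0 t) :
    HasDerivAt (fun τ => Real.exp (-lam * τ) * G (u x τ)) (discountedRate lam G T u x τ) τ := by
  have hτT : Icc 0 T ∈ 𝓝 τ := Icc_mem_nhds hτ.1 (hτ.2.trans_le ht.2)
  have hvalue := ((hG.differentiable one_ne_zero) (u x τ)).hasDerivAt.comp τ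
    ((hasDerivWithinAt_timeDeriv hu x (mem_of_mem_nhds hτT)).hasDerivAt hτT)
  have hexp := ((hasDerivAt_id' τ).const_mul (-lam)).exp
  refine (hexp.mul hvalue).congr_deriv ?_
  simp only [discountedRate, Function.comp_apply]
  ring

lemma exp_mul_integral_eq (hu0 : ∀ x, u x 0 = 0) (hG0 : G 0 = 0) {w : Space N → ℝ}
    (hw : Continuous w) (hwc : HasCompactSupport w) (lam : ℝ) :
    Real.exp (-lam * t) * ∫ x, w x * G (u x t) =
      ∫ τ in Ioc 0 t, ∫ x, w x * discountedRate lam G T u x τ := by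
  have hcont : ∀ x, ContinuousOn (fun τ => Real.exp (-lam * τ) * G (u x τ)) (Icc 0 t) := by
    intro x
    have hux : ContinuousOn (u x) (Icc 0 t) := fun τ hτ =>
      (hasDerivWithinAt_timeDeriv hu x ⟨hτ.1, hτ.2.trans ht.2⟩).continuousWithinAt.mono
        (Icc_subset_Icc_right ht.2)
    exact ContinuousOn.mul (by fun_prop) (hG.continuous.comp_continuousOn hux)
  rw [← integral_mul_eq_integral_integral hw hwc (continuousOn_discountedRate hu hG ht lam)
    ht.1.le hcont (fun x τ hτ => hasDerivAt_exp_mul_comp hu hG ht lam x hτ)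
    fun x => by rw [hu0, hG0, mul_zero], ← integral_const_mul]
  exact integral_congr_ae (ae_of_all _ fun x => mul_left_comm _ _ _)

end DiscountedRate

end Strip

/-! ### Uniqueness -/

section TestError

variable {N : ℕ} {ν β : ℝ} {X : Type*} [MeasurableSpace X] {μ : Measure X} {g : X → ℝ}
  {y : X → Space N}

lemma aestronglyMeasurable_mul_testError (hy : Measurable y)
    (hg : AEStronglyMeasurable (fun z => g z * psi β (y z)) μ) (R : ℝ) :
    AEStronglyMeasurable (fun z => g z * testError ν β R (y z)) μ := by
  have hratio : Measurable fun z => testError ν β R (y z) / psi β (y z) :=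
    ((measurable_testError ν β R).comp hy).div ((continuous_psi β).measurable.comp hy)
  refine (hg.mul hratio.aestronglyMeasurable).congr (ae_of_all _ fun z => ?_)
  have := (psi_pos β (y z)).ne'
  simp only [Pi.mul_apply]
  field_simp

variable (hν : N < ν) (hβ : 0 ≤ β) (hβν : β ≤ ν)

include hν hβ hβν

lemma exists_norm_mul_testError_le : ∃ B, ∀ R, 1 ≤ R → ∀ (a : ℝ) (x : Space N),
    ‖a * testError ν β R x‖ ≤ B * ‖a * psi β x‖ := by
  obtain ⟨B, hB⟩ := exists_testError_le (N := N) hν hβ hβν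
  refine ⟨B, fun R hR a x => ?_⟩
  rw [norm_mul, norm_mul, Real.norm_of_nonneg (testError_nonneg (zero_le_one.trans hR) x),
    Real.norm_of_nonneg (psi_pos β x).le, mul_left_comm]
  exact mul_le_mul_of_nonneg_left (hB R hR x) (norm_nonneg a)

lemma integrable_mul_testError (hy : Measurable y) (hg : Integrable (fun z => g z * psi β (y z)) μ)
    {R : ℝ} (hR : 1 ≤ R) : Integrable (fun z => g z * testError ν β R (y z)) μ := by
  obtain ⟨B, hB⟩ := exists_norm_mul_testError_le (N := N) hν hβ hβν
  exact (hg.norm.const_mul B).mono'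
    (aestronglyMeasurable_mul_testError hy hg.aestronglyMeasurable R)
    (ae_of_all _ fun z => hB R hR (g z) (y z))

lemma tendsto_integral_mul_testError (hy : Measurable y)
    (hg : Integrable (fun z => g z * psi β (y z)) μ) :
    Tendsto (fun n : ℕ => ∫ z, g z * testError ν β ((n : ℝ) + 1) (y z) ∂μ) atTop (𝓝 0) := by
  obtain ⟨B, hB⟩ := exists_norm_mul_testError_le (N := N) hν hβ hβν
  rw [← integral_zero X ℝ (μ := μ)]
  refine tendsto_integral_of_dominated_convergence (fun z => B * ‖g z * psi β (y z)‖)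
    (fun n => aestronglyMeasurable_mul_testError hy hg.aestronglyMeasurable _)
    (hg.norm.const_mul B)
    (fun n => ae_of_all _ fun z => hB _ (le_add_of_nonneg_left n.cast_nonneg) (g z) (y z))
    (ae_of_all _ fun z => ?_)
  rw [← mul_zero (g z)]
  exact (tendsto_testError hν hβ (y z)).const_mul (g z)

end TestError

section Rate

variable {N : ℕ} {ν c lam : ℝ} {f φ ρ V e : Space N → ℝ} {G : ℝ → ℝ}

lemma integral_mul_rate_le (hN : 1 ≤ N) (hν : N < ν) (hν' : ν < N + 2) (hc : 0 ≤ c)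
    (hG : ContDiff ℝ 1 G) (hGconv : ConvexOn ℝ univ G) (hG0 : ∀ a, 0 ≤ G a)
    (hf : ContDiff ℝ 2 f) (hft : TailIntegrable ν f) (hGt : TailIntegrable ν (G ∘ f))
    (hρ : Continuous ρ) (hV : Continuous V)
    (hfV : ∀ x, Tendsto (fun h => mixedOperator c ν h f x) (𝓝[>] 0) (𝓝 (ρ x * V x)))
    (hφ : Continuous φ) (hφc : HasCompactSupport φ) (hφ0 : ∀ x, 0 ≤ φ x)
    (htest : ∀ h, 0 < h → h ≤ 1 / 2 → ∀ x,
      mixedOperator c ν h φ x ≤ lam * (ρ x * φ x) + e x)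
    (he : Integrable fun x => G (f x) * e x) :
    ∫ x, ρ x * φ x * (deriv G (f x) * V x - lam * G (f x)) ≤ ∫ x, G (f x) * e x := by
  have hGf := hG.continuous.comp hf.continuous
  have hGf' := (hG.continuous_deriv le_rfl).comp hf.continuous
  have hvalue : Integrable fun x => lam * (ρ x * φ x * G (f x)) :=
    (((hρ.mul hφ).mul hGf).integrable_of_hasCompactSupport hφc.mul_left.mul_right).const_mul lam
  have hrate : Integrable fun x => φ x * deriv G (f x) * (ρ x * V x) :=
    ((hφ.mul hGf').mul (hρ.mul hV)).integrable_of_hasCompactSupport hφc.mul_right.mul_right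
  have hsplit : (fun x => G (f x) * (lam * (ρ x * φ x) + e x)) =
      fun x => lam * (ρ x * φ x * G (f x)) + G (f x) * e x := by
    ext x
    ring
  have hlim := integral_comp_test_le hN hν hν' hc
    (fun a b => tangent_le_of_convexOn_univ hGconv ((hG.differentiable one_ne_zero) a) b) hG0
    hG.continuous (hG.continuous_deriv le_rfl) hf hft hGt hfV hφ hφc hφ0 htest
    (hsplit ▸ hvalue.add he)
  rw [hsplit, integral_add hvalue he] at hlim
  calc ∫ x, ρ x * φ x * (deriv G (f x) * V x - lam * G (f x))
      = ∫ x, φ x * deriv G (f x) * (ρ x * V x) - lam * (ρ x * φ x * G (f x)) := by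
        congr 1
        ext x
        ring
    _ ≤ ∫ x, G (f x) * e x := by
        rw [integral_sub hrate hvalue]
        linarith

lemma integrable_profile_mul {p : ℝ} (hp : 1 ≤ p) (hf : Continuous f) (he : Measurable e)
    (he0 : ∀ x, 0 ≤ e x) (hint : Integrable fun x => |f x| ^ p * e x) :
    Integrable fun x => profile p (f x) * e x := by
  refine hint.mono' (((contDiff_profile hp).continuous.comp hf).measurable.mul
    he).aestronglyMeasurable (ae_of_all _ fun x => ?_)
  rw [Real.norm_of_nonneg (mul_nonneg (profile_nonneg p _) (he0 x))]
  exact mul_le_mul_of_nonneg_right (profile_le_abs_rpow (by linarith) (f x)) (he0 x)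

end Rate

section AssumptionH0

variable {N : ℕ} {α C₀ : ℝ} {ρ : Space N → ℝ}

lemma AssumptionH0.pos (hρ : AssumptionH0 ρ α C₀) (x : Space N) : 0 < ρ x :=
  (mul_pos hρ.const_pos (psi_pos α x)).trans_le (hρ.lower_bound x)

lemma AssumptionH0.bracket_rpow_le (hρ : AssumptionH0 ρ α C₀) (x : Space N) :
    bracket x ^ (-α) ≤ ρ x / C₀ := by
  rw [le_div_iff₀' hρ.const_pos, ← psi_eq_bracket]
  exact hρ.lower_bound x

end AssumptionH0

section TestFunction

variable {N : ℕ} {R β : ℝ}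

lemma testFun_le_testFun {R' : ℝ} (hR : 0 < R) (h : 2 * R ≤ R') (x : Space N) :
    testFun R β x ≤ testFun R' β x :=
  mul_le_mul_of_nonneg_right (cutoff_le_cutoff hR h x) (psi_pos β x).le

variable {ρ f : Space N → ℝ} {p : ℝ} (hρ : Continuous ρ) (hρ0 : ∀ x, 0 < ρ x) (hp : 1 ≤ p)
  (hf : Continuous f) (hR : 0 < R)

include hρ hp hf

lemma continuous_mul_testFun_mul_profile (R β : ℝ) :
    Continuous fun x => ρ x * testFun R β x * profile p (f x) :=
  (hρ.mul (continuous_testFun R β)).mul ((contDiff_profile hp).continuous.comp hf)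

include hρ0 hR

lemma integral_testFun_mul_profile_mono {R' : ℝ} (h : 2 * R ≤ R') :
    ∫ x, ρ x * testFun R β x * profile p (f x) ≤ ∫ x, ρ x * testFun R' β x * profile p (f x) := by
  have hint : ∀ r, 0 < r → Integrable fun x => ρ x * testFun r β x * profile p (f x) :=
    fun r hr => (continuous_mul_testFun_mul_profile hρ hp hf r β).integrable_of_hasCompactSupport
      (hasCompactSupport_testFun hr β).mul_left.mul_right
  refine integral_mono (hint R hR) (hint R' (by linarith)) fun x => ?_
  exact mul_le_mul_of_nonneg_right
    (mul_le_mul_of_nonneg_left (testFun_le_testFun hR h x) (hρ0 x).le) (profile_nonneg p (f x))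

lemma eq_zero_of_integral_testFun_mul_profile_nonpos {x : Space N} (hx : ‖x‖ ≤ R)
    (hle : ∫ x, ρ x * testFun R β x * profile p (f x) ≤ 0) : f x = 0 := by
  have hp0 : p ≠ 0 := (one_pos.trans_le hp).ne'
  by_contra hfx
  refine hle.not_gt ((continuous_mul_testFun_mul_profile hρ hp hf R
    β).integral_pos_of_hasCompactSupport_nonneg_nonzero (x := x)
    (hasCompactSupport_testFun hR β).mul_left.mul_right (fun z => ?_) ?_)
  · exact mul_nonneg (mul_nonneg (hρ0 z).le (testFun_nonneg R β z)) (profile_nonneg p (f z))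
  · rw [testFun, cutoff_eq_one hR hx, one_mul]
    exact mul_ne_zero (mul_ne_zero (hρ0 x).ne' (psi_pos β x).ne')
      fun h => hfx (eq_zero_of_profile_eq_zero hp0 h)

end TestFunction

section Energy

variable {N : ℕ} {T s α β C₀ C p R : ℝ} {ρ : Space N → ℝ} {u : Space N → ℝ → ℝ}
  (hN : 1 ≤ N) (hs : s ∈ Ioo (0 : ℝ) 1) (hρ : AssumptionH0 ρ α C₀) (hβ : 0 ≤ β)
  (hβν : β ≤ N + 2 * s) (hp : 1 ≤ p)
  (hu : ContDiffOn ℝ 2 (fun z : Space N × ℝ => u z.1 z.2) (univ ×ˢ Icc 0 T))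
  (heq : IsSolutionEquation s T ρ u)

lemma MemLpPsi.integrable (h : MemLpPsi p β T u) :
    Integrable (fun z : Space N × ℝ => |u z.1 z.2| ^ p * psi β z.1)
      ((volume : Measure (Space N)).prod (volume.restrict (Ioc 0 T))) := by
  have hnonneg (z : Space N × ℝ) : 0 ≤ |u z.1 z.2| ^ p * psi β z.1 :=
    mul_nonneg (by positivity) (psi_pos β z.1).le
  rw [← volume_restrict_strip]
  refine ⟨(h.1.norm.aemeasurable.pow_const p).aestronglyMeasurable.mul
    ((continuous_psi β).comp continuous_fst).aestronglyMeasurable, ?_⟩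
  exact (hasFiniteIntegral_iff_ofReal (ae_of_all _ hnonneg)).2 h.2

lemma MemLpPsi.mono {β' : ℝ} (h : MemLpPsi p β T u) (hββ' : β ≤ β') : MemLpPsi p β' T u := by
  have hle (z : Space N × ℝ) : |u z.1 z.2| ^ p * psi β' z.1 ≤ |u z.1 z.2| ^ p * psi β z.1 :=
    mul_le_mul_of_nonneg_left (psi_le_psi_of_exponent_le hββ' z.1) (by positivity)
  refine ⟨h.1, h.2.trans_le' (lintegral_mono fun z => ?_)⟩
  exact ENNReal.ofReal_le_ofReal (hle z)

lemma integral_abs_rpow_mul_testError_nonneg (s β : ℝ) (hR : 0 ≤ R) (τ : ℝ) :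
    0 ≤ ∫ x, |u x τ| ^ p * testError (N + 2 * s) β R x :=
  integral_nonneg fun x => mul_nonneg (Real.rpow_nonneg (abs_nonneg _) p) (testError_nonneg hR x)

include hN hs hρ hβ hβν hp hu heq

section FixedTime

variable (hC : 0 ≤ C) (hR : 1 ≤ R)
  (htest : ∀ h, 0 < h → h ≤ 1 / 2 → ∀ x : Space N,
    mixedOperator (fracConst N s) (N + 2 * s) h (testFun R β) x ≤
      C * (bracket x ^ (-α) * testFun R β x + testError (N + 2 * s) β R x))
  {τ : ℝ} (hτ : τ ∈ Ioc 0 T) (hint : Integrable fun x => |u x τ| ^ p * psi β x)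

include hC hR htest hτ hint

lemma integral_mul_profile_rate_le :
    ∫ x, ρ x * testFun R β x * (deriv (profile p) (u x τ) * timeDeriv T u (x, τ) -
        C / C₀ * profile p (u x τ)) ≤
      C * ∫ x, |u x τ| ^ p * testError (N + 2 * s) β R x := by
  have hν : (N : ℝ) < N + 2 * s := by linarith [hs.1]
  have herr0 (x : Space N) := testError_nonneg (ν := N + 2 * s) (β := β) (zero_le_one.trans hR) x
  have hf := contDiff_slice hu (Ioc_subset_Icc_self hτ)
  have herr : Integrable fun x => |u x τ| ^ p * testError (N + 2 * s) β R x :=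
    integrable_mul_testError hν hβ hβν measurable_id hint hR
  have hGerr : Integrable fun x => profile p (u x τ) * testError (N + 2 * s) β R x :=
    integrable_profile_mul hp hf.continuous (measurable_testError _ β R) herr0 herr
  have hGt : TailIntegrable (N + 2 * s) (profile p ∘ fun x => u x τ) :=
    tailIntegrable_of_integrable_mul_psi (hβ.trans hβν) hβν
      (integrable_profile_mul hp hf.continuous (continuous_psi β).measurable
        (fun x => (psi_pos β x).le) hint)
  have htest' : ∀ h, 0 < h → h ≤ 1 / 2 → ∀ x : Space N,
      mixedOperator (fracConst N s) (N + 2 * s) h (testFun R β) x ≤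
        C / C₀ * (ρ x * testFun R β x) + C * testError (N + 2 * s) β R x := by
    intro h hh hh' x
    have hφ := testFun_nonneg R β x
    calc mixedOperator (fracConst N s) (N + 2 * s) h (testFun R β) x
        ≤ C * (ρ x / C₀ * testFun R β x + testError (N + 2 * s) β R x) := by
          refine (htest h hh hh' x).trans ?_
          gcongr
          exact hρ.bracket_rpow_le x
      _ = C / C₀ * (ρ x * testFun R β x) + C * testError (N + 2 * s) β R x := by ring
  refine (integral_mul_rate_le hN hν (by linarith [hs.2]) (fracConst_nonneg hs)
    (contDiff_profile hp) (convexOn_profile hp) (profile_nonneg p) hf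
    ((heq.memLs τ hτ).tailIntegrable hs.1.le) hGt hρ.continuous
    (continuous_timeDeriv_slice hu (hτ.1.trans_le hτ.2) (Ioc_subset_Icc_self hτ))
    (heq.tendsto_mixedOperator hu hτ) (continuous_testFun R β)
    (hasCompactSupport_testFun (one_pos.trans_le hR) β) (testFun_nonneg R β) htest'
    (by simpa only [mul_left_comm] using hGerr.const_mul C)).trans ?_
  simp only [mul_left_comm _ C, integral_const_mul]
  exact mul_le_mul_of_nonneg_left (integral_mono hGerr herr fun x => mul_le_mul_of_nonneg_right
    (profile_le_abs_rpow (zero_le_one.trans hp) (u x τ)) (herr0 x)) hC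

lemma integral_mul_discountedRate_le :
    ∫ x, ρ x * testFun R β x * discountedRate (C / C₀) (profile p) T u x τ ≤
      C * ∫ x, |u x τ| ^ p * testError (N + 2 * s) β R x := by
  have hexp : Real.exp (-(C / C₀) * τ) ≤ 1 := by
    rw [Real.exp_le_one_iff, neg_mul, neg_nonpos]
    exact mul_nonneg (div_nonneg hC hρ.const_pos.le) hτ.1.le
  have herr := integral_abs_rpow_mul_testError_nonneg (p := p) (u := u) s β
    (zero_le_one.trans hR) τ
  simp only [discountedRate, mul_left_comm _ (Real.exp _), integral_const_mul]
  refine le_trans ?_ (mul_le_of_le_one_left (mul_nonneg hC herr) hexp)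
  exact mul_le_mul_of_nonneg_left
    (integral_mul_profile_rate_le hN hs hρ hβ hβν hp hu heq hC hR htest hτ hint)
    (Real.exp_pos _).le

end FixedTime

lemma energy_le (huψ : MemLpPsi p β T u) (hu0 : ∀ x, u x 0 = 0) (hC : 0 ≤ C) (hR : 1 ≤ R)
    (htest : ∀ h, 0 < h → h ≤ 1 / 2 → ∀ x : Space N,
      mixedOperator (fracConst N s) (N + 2 * s) h (testFun R β) x ≤
        C * (bracket x ^ (-α) * testFun R β x + testError (N + 2 * s) β R x))
    {t : ℝ} (ht : t ∈ Ioc 0 T) :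
    Real.exp (-(C / C₀) * t) * ∫ x, ρ x * testFun R β x * profile p (u x t) ≤
      C * ∫ z, |u z.1 z.2| ^ p * testError (N + 2 * s) β R z.1
        ∂((volume : Measure (Space N)).prod (volume.restrict (Ioc 0 T))) := by
  have hν : (N : ℝ) < N + 2 * s := by linarith [hs.1]
  have hw : Continuous fun x => ρ x * testFun R β x := hρ.continuous.mul (continuous_testFun R β)
  have hwc : HasCompactSupport fun x => ρ x * testFun R β x :=
    (hasCompactSupport_testFun (one_pos.trans_le hR) β).mul_left
  have hsub : Ioc 0 t ⊆ Ioc 0 T := Ioc_subset_Ioc_right ht.2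
  have herr := integrable_mul_testError hν hβ hβν measurable_fst huψ.integrable hR
  have hE : Integrable (fun τ => C * ∫ x, |u x τ| ^ p * testError (N + 2 * s) β R x)
      (volume.restrict (Ioc 0 T)) := herr.integral_prod_right.const_mul C
  have hE0 : ∀ τ, 0 ≤ C * ∫ x, |u x τ| ^ p * testError (N + 2 * s) β R x := fun τ =>
    mul_nonneg hC (integral_abs_rpow_mul_testError_nonneg s β (zero_le_one.trans hR) τ)
  rw [exp_mul_integral_eq hu (contDiff_profile hp) ht hu0
    (profile_zero (one_pos.trans_le hp).ne') hw hwc, integral_prod_symm _ herr,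
    ← integral_const_mul]
  refine le_trans (integral_mono_ae (integrable_mul_strip hw hwc (continuousOn_discountedRate hu
    (contDiff_profile hp) ht _)).integral_prod_right (hE.mono_measure
      (Measure.restrict_mono hsub le_rfl)) ?_)
    (setIntegral_mono_set hE (ae_of_all _ hE0) hsub.eventuallyLE)
  filter_upwards [ae_mono (Measure.restrict_mono hsub le_rfl) huψ.integrable.prod_left_ae,
    ae_restrict_mem measurableSet_Ioc] with τ hint hτ
  exact integral_mul_discountedRate_le hN hs hρ hβ hβν hp hu heq hC hR htest (hsub hτ) hint

theorem eq_zero_of_nonlocal_psi_bound (hα : α ≤ 2) {K : ℝ} (hK0 : 0 ≤ K)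
    (hK : ∀ ε, 0 < ε → ∀ x : Space N,
      -nonlocal (N + 2 * s) ε (psi β) x ≤ K * bracket x ^ (-α) * psi β x)
    (hu0 : ∀ x, u x 0 = 0) (huψ : MemLpPsi p β T u) (x : Space N) {t : ℝ} (ht : t ∈ Ioc 0 T) :
    u x t = 0 := by
  have hν : (N : ℝ) < N + 2 * s := by linarith [hs.1]
  obtain ⟨C, hC, htest⟩ := exists_mixedOperator_testFun_le hN hν (by linarith [hs.2]) hβ hα
    (fracConst_nonneg (N := N) hs) hK0 hK
  have hf := (contDiff_slice hu (Ioc_subset_Icc_self ht)).continuous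
  have hR : 0 < ‖x‖ + 1 := by positivity
  refine eq_zero_of_integral_testFun_mul_profile_nonpos (β := β) (x := x) hρ.continuous hρ.pos hp
    hf hR (le_add_of_nonneg_right zero_le_one) ?_
  have hlim := (tendsto_integral_mul_testError hν hβ hβν measurable_fst
    huψ.integrable).const_mul C
  rw [mul_zero] at hlim
  refine nonpos_of_mul_nonpos_right (ge_of_tendsto hlim ?_) (Real.exp_pos (-(C / C₀) * t))
  filter_upwards [eventually_ge_atTop ⌈2 * (‖x‖ + 1)⌉₊] with n hn
  have hn1 : 2 * (‖x‖ + 1) ≤ (n : ℝ) + 1 := (Nat.ceil_le.1 hn).trans (by linarith)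
  have hn0 : (1 : ℝ) ≤ (n : ℝ) + 1 := le_add_of_nonneg_left n.cast_nonneg
  exact (mul_le_mul_of_nonneg_left (integral_testFun_mul_profile_mono hρ.continuous hρ.pos hp hf
    hR hn1) (Real.exp_pos _).le).trans
      (energy_le hN hs hρ hβ hβν hp hu heq huψ hu0 hC hn0 (htest _ hn0) ht)

end Energy

lemma ExponentCondition.le_two {N : ℕ} {s α β : ℝ} (hs : s ∈ Ioo (0 : ℝ) 1)
    (h : ExponentCondition N s α β) : α ≤ 2 := by
  have := hs.2
  rcases h with ⟨-, -, h⟩ | ⟨-, -, h⟩ | ⟨-, h⟩ | ⟨hβ, h⟩ <;> linarith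

lemma ExponentCondition.exists_neg_nonlocal_psi_le {N : ℕ} {s α β : ℝ} (hN : 1 ≤ N)
    (hs : s ∈ Ioo (0 : ℝ) 1) (hα : 0 ≤ α) (h : ExponentCondition N s α β) :
    ∃ β', β ≤ β' ∧ 0 ≤ β' ∧ β' ≤ N + 2 * s ∧ ∃ K, 0 ≤ K ∧ ∀ ε, 0 < ε → ∀ x : Space N,
      -nonlocal (N + 2 * s) ε (psi β') x ≤ K * bracket x ^ (-α) * psi β' x := by
  obtain ⟨hs0, hs1⟩ := hs
  have hN0 : (0 : ℝ) < N := by exact_mod_cast hN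
  have hν : (N : ℝ) < N + 2 * s := by linarith
  have hν' : (N : ℝ) + 2 * s < N + 2 := by linarith
  rcases h with ⟨hβ, hβ', -⟩ | ⟨-, hβ, hα'⟩ | ⟨hβ, hα'⟩ | ⟨hβ, hαβ⟩
  · refine ⟨N - 2 * s, hβ', by linarith, by linarith, 0, le_rfl, fun ε hε x => ?_⟩
    rw [zero_mul, zero_mul, neg_nonpos]
    exact nonlocal_psi_critical_nonneg hN hν (by linarith) (by ring) hε x
  · have hβ' : max β (N / 2) < N := max_lt hβ (half_lt_self hN0)
    have hpos : 0 < max β ((N : ℝ) / 2) := lt_max_of_lt_right (half_pos hN0)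
    exact ⟨max β (N / 2), le_max_left _ _, hpos.le, by linarith,
      exists_neg_nonlocal_psi_le_of_lt_dim hN hν hν' hpos hβ' (by linarith)⟩
  · exact ⟨N + 2 * s - α, by linarith, by linarith, by linarith,
      exists_neg_nonlocal_psi_le_of_dim_lt hN hν' (by linarith) hα (by linarith)⟩
  · exact ⟨β, le_rfl, by linarith, by linarith,
      exists_neg_nonlocal_psi_le_of_dim_lt hN hν' hβ hα (by linarith)⟩

end MixedParabolic

end

theorem theorem5p3_general {N : ℕ} (hN : 1 ≤ N) {s : ℝ} (hs : s ∈ Set.Ioo (0 : ℝ) 1) {T : ℝ}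
    {ρ : MixedParabolic.Space N → ℝ} {α C₀ : ℝ} (hρ : MixedParabolic.AssumptionH0 ρ α C₀)
    {β : ℝ} (hcond : MixedParabolic.ExponentCondition N s α β) {p : ℝ} (hp : 1 ≤ p)
    {u : MixedParabolic.Space N → ℝ → ℝ}
    (hu : ContDiffOn ℝ 2 (fun z : MixedParabolic.Space N × ℝ => u z.1 z.2)
      (Set.univ ×ˢ Set.Icc 0 T))
    (heq : MixedParabolic.IsSolutionEquation s T ρ u) (hu0 : ∀ x, u x 0 = 0)
    (huψ : MixedParabolic.MemLpPsi p β T u) :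
    ∀ x, ∀ t ∈ Set.Ioc 0 T, u x t = 0 := by
  intro x t ht
  obtain ⟨β', hββ', hβ', hβ'ν, K, hK, hψ⟩ :=
    hcond.exists_neg_nonlocal_psi_le hN hs hρ.alpha_nonneg
  exact MixedParabolic.eq_zero_of_nonlocal_psi_bound hN hs hρ hβ' hβ'ν hp hu heq
    (hcond.le_two hs) hK hψ hu0 (huψ.mono hββ') x ht

theorem theorem5p3 (N : ℕ) (hN : 1 ≤ N) (s : ℝ) (hs : s ∈ Set.Ioo (0 : ℝ) 1)
    (T : ℝ) (hT : 0 < T) (ρ : MixedParabolic.Space N → ℝ) (α C₀ : ℝ)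
    (hρ : MixedParabolic.AssumptionH0 ρ α C₀)
    (β : ℝ) (hβ : 0 < β) (hcond : MixedParabolic.ExponentCondition N s α β)
    (p : ℝ) (hp : 1 ≤ p) (u : MixedParabolic.Space N → ℝ → ℝ)
    (hu : MixedParabolic.IsSolutionProblem s T ρ u)
    (hup : ∀ t ∈ Set.Ioc 0 T, MixedParabolic.MemLs s (fun x => |u x t| ^ p))
    (huψ : MixedParabolic.MemLpPsi p β T u) :
    ∀ x, ∀ t ∈ Set.Ioc 0 T, u x t = 0 :=
  theorem5p3_general hN hs hρ hcond hp hu.contDiffOn hu.solution hu.initial huψ
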